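/- Let $D$ be a principal ideal domain that is not a field, and let $$R(D)=\left\{\begin{pmatrix} a & b\\ 0 & a\end{pmatrix} : a,b\in D\right\}$$ be its self-idealization, a commutative subring of the ring of $2\times 2$ matrices over $D$. Then $R(D)$ is locally tame and has catenary degree $\mathsf c(R(D))=4$. In particular, $\Delta(R(D))=[1,\mathsf c(R(D))-2]=\{1,2\}$. The notions are as follows, for a commutative ring $R$. Elements $a,b\in R$ are associates if $aR=bR$. A nonunit $a$ is irreducible if $a=bc$ implies that $b$ or $c$ is an associate of $a$, and $R$ is atomic if every nonzero nonunit is a finite product of irreducibles. For a nonzero nonunit $a$, let $\mathsf Z(a)$ be the set of factorizations of $a$ into irreducibles, up to order and associates (finite multisets of classes of associated irreducibles), and let $\mathsf L(a)$ be the set of lengths of these factorizations. The set $\Delta(a)$ consists of all $l-k$ with $k<l$ in $\mathsf L(a)$ and no element of $\mathsf L(a)$ strictly between them, and $\Delta(R)$ is the union of the $\Delta(a)$ over all nonzero nonunits $a$. The distance of two factorizations is $\mathsf d(z,z')=\max\{|z\setminus z'|,|z'\setminus z|\}$ (multiset differences, i.e. after removing the greatest common part). The catenary degree $\mathsf c(a)$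 is the least $N\in\mathbb N_0\cup\{\infty\}$ such that any $z,z'\in\mathsf Z(a)$ are joined by a finite chain $z=z_0,\dots,z_k=z'$ in $\mathsf Z(a)$ with $\mathsf d(z_{i-1},z_i)\le N$ for all $i$, and $\mathsf c(R)$ is the supremum of $\mathsf c(a)$ over all nonzero nonunits $a$. For an irreducible $u$, $\mathsf t(a,u)$ is the least $N\in\mathbb N_0\cup\{\infty\}$ such that, if some factorization in $\mathsf Z(a)$ contains the class of $u$, then for every $z\in\mathsf Z(a)$ there is $z'\in\mathsf Z(a)$ containing the class of $u$ with $\mathsf d(z,z')\le N$; and $\mathsf t(R,u)$ is the supremum of $\mathsf t(a,u)$ over all nonzero nonunits $a$. The ring $R$ is locally tame if it is atomic and $\mathsf t(R,u)<\infty$ for every irreducible $u$. -/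

import Mathlib

namespace SelfIdeal

/-- The self-idealization `R(D)`: the subring of `2 × 2` matrices over `D` of the form
`(a b; 0 a)`. -/
def selfIdealization (D : Type*) [CommRing D] : Subring (Matrix (Fin 2) (Fin 2) D) where
  carrier := {M | ∃ a b : D, M = !![a, b; 0, a]}
  mul_mem' := by
    rintro _ _ ⟨a, b, rfl⟩ ⟨x, y, rfl⟩
    exact ⟨a * x, a * y + b * x, by simp [Matrix.mul_fin_two]⟩
  one_mem' := ⟨1, 0, by simp [Matrix.one_fin_two]⟩
  add_mem' := by
    rintro _ _ ⟨a, b, rfl⟩ ⟨x, y, rfl⟩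
    exact ⟨a + x, b + y, by simp⟩
  zero_mem' := ⟨0, 0, by ext i j; fin_cases i <;> fin_cases j <;> rfl⟩
  neg_mem' := by
    rintro _ ⟨a, b, rfl⟩
    exact ⟨-a, -b, by simp⟩

instance selfIdealization.instCommRing (D : Type*) [CommRing D] :
    CommRing (selfIdealization D) :=
  { (selfIdealization D).toRing with
    mul_comm := by
      rintro ⟨_, a, b, rfl⟩ ⟨_, x, y, rfl⟩
      apply Subtype.ext
      change !![a, b; 0, a] * !![x, y; 0, x] = !![x, y; 0, x] * !![a, b; 0, a]
      simp only [Matrix.mul_fin_two]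
      congr 1
      ring_nf }

section Factorizations

variable {R : Type*} [CommRing R]

/-- Elements `a`, `b` of a commutative ring (possibly with zero-divisors) are associates
if `aR = bR`. -/
def AreAssociates (a b : R) : Prop :=
  Ideal.span {a} = Ideal.span {b}

/-- Irreducible elements (atoms) of a commutative ring, possibly with zero-divisors: nonunits `a`
such that `a = b * c` implies that `b` or `c` is an associate of `a`. -/
def IsAtomElt (a : R) : Prop :=
  ¬ IsUnit a ∧ ∀ b c : R, a = b * c → AreAssociates b a ∨ AreAssociates c a

/-- The set of lengths `L(a)` (used for nonzero nonunits `a` only). -/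
def lengthSet (a : R) : Set ℕ :=
  {k | ∃ s : Multiset R, (∀ u ∈ s, IsAtomElt u) ∧ s.prod = a ∧ Multiset.card s = k}

/-- The set of distances `Δ(a)`: differences of successive elements of `L(a)`. -/
def distances (a : R) : Set ℕ :=
  {d | ∃ k ∈ lengthSet a, ∃ l ∈ lengthSet a,
    k < l ∧ (∀ m ∈ lengthSet a, ¬ (k < m ∧ m < l)) ∧ d = l - k}

/-- The set `Z(a)` of factorizations of `a` (used for nonzero nonunits `a` only) into irreducibles,
up to order and associates. The class of `u` up to associates is recorded by the
principal ideal `uR`, so that a factorization is a multiset of principal ideals. -/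
def factorizations (a : R) : Set (Multiset (Ideal R)) :=
  {z | ∃ s : Multiset R, (∀ u ∈ s, IsAtomElt u) ∧ s.prod = a ∧
    z = s.map (fun u => Ideal.span {u})}

open Classical in
/-- The distance `d(z, z') = max {|z / gcd(z, z')|, |z' / gcd(z, z')|}` of two factorizations;
the truncated difference `z - z'` of multisets is `z` with the common part `z ∩ z'` removed. -/
noncomputable def factDist (z z' : Multiset (Ideal R)) : ℕ :=
  max (Multiset.card (z - z')) (Multiset.card (z' - z))

/-- `z` and `z'` can be concatenated by an `N`-chain of factorizations of `a`. -/
def ChainConnected (a : R) (N : ℕ∞) : Multiset (Ideal R) → Multiset (Ideal R) → Prop :=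
  Relation.ReflTransGen fun x y =>
    x ∈ factorizations a ∧ y ∈ factorizations a ∧ (factDist x y : ℕ∞) ≤ N

/-- The catenary degree `c(a)`: the least `N ∈ ℕ₀ ∪ {∞}` such that any two factorizations of `a`
can be concatenated by an `N`-chain. -/
noncomputable def catenaryDegreeAt (a : R) : ℕ∞ :=
  sInf {N : ℕ∞ | ∀ z ∈ factorizations a, ∀ z' ∈ factorizations a, ChainConnected a N z z'}

/-- The tame degree `t(a, x)`: the least `N ∈ ℕ₀ ∪ {∞}` such that, if some factorization of `a` is
divisible by `x`, then for every factorization `z` of `a` there is a factorization `z'` of `a`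
divisible by `x` with `d(z, z') ≤ N`. -/
noncomputable def tameDegreeAt (a : R) (x : Multiset (Ideal R)) : ℕ∞ :=
  sInf {N : ℕ∞ | (∃ w ∈ factorizations a, x ≤ w) →
    ∀ z ∈ factorizations a, ∃ z' ∈ factorizations a, x ≤ z' ∧ (factDist z z' : ℕ∞) ≤ N}

end Factorizations

section RingInvariants

variable (R : Type*) [CommRing R]

/-- The set of distances `Δ(R)`, the union of the `Δ(a)` over all nonzero nonunits `a`. -/
def ringDistances : Set ℕ :=
  {d | ∃ a : R, a ≠ 0 ∧ ¬ IsUnit a ∧ d ∈ distances a}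

/-- The catenary degree `c(R)`, the supremum of the `c(a)` over all nonzero nonunits `a`. -/
noncomputable def catenaryDegree : ℕ∞ :=
  ⨆ a : {a : R // a ≠ 0 ∧ ¬ IsUnit a}, catenaryDegreeAt a.1

/-- The tame degree `t(R, u)` of an irreducible `u`, the supremum of the `t(a, u)` over all
nonzero nonunits `a`. -/
noncomputable def tameDegree (u : R) : ℕ∞ :=
  ⨆ a : {a : R // a ≠ 0 ∧ ¬ IsUnit a}, tameDegreeAt a.1 {Ideal.span {u}}

/-- `R` is atomic: every nonzero nonunit is a finite product of irreducible elements. -/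
def IsAtomicRing : Prop :=
  ∀ a : R, a ≠ 0 → ¬ IsUnit a → ∃ s : Multiset R, (∀ u ∈ s, IsAtomElt u) ∧ s.prod = a

/-- `R` is locally tame: it is atomic and `t(R, u) < ∞` for every irreducible `u`. -/
def IsLocallyTame : Prop :=
  IsAtomicRing R ∧ ∀ u : R, IsAtomElt u → tameDegree R u < ⊤

end RingInvariants

end SelfIdeal

/-!
The ring `R(D)` consists of the elements `pair a b = a + b ε` with `ε ^ 2 = 0`. Its zero-divisors
are the multiples of `ε`, hence nilpotent, and therefore generators of the same ideal differ by a
unit and the regular elements form a cancellative monoid. Since elements may be normalized by units,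
a factorization of a nonunit `a` is the same as a multiset of ideals generated by irreducible
elements with product `aR` (`mem_factorizations_iff`), and the argument takes place in the monoid
of ideals.

Up to associates the irreducible elements are `ε` and the `(p ^ k, y)` with `p` prime and `k = 1` or
`p ∤ y` (`IsAtomElt.classify`). Factors over different primes do not interact
(`pair_dvd_of_dvd_mul`).

*Upper bounds.* Any two factorizations of an element are linked by steps of distance at most `4` that
change the length by at most `2` (`linked_of_mem_factorizations`), which bounds both the catenary
degree and the set of distances. For a regular element this is an induction: if at least two factors
over a prime `p` occur, then explicit identities link their product to one that involves `(p, 0)`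
(`exists_linked_pair`), and otherwise the only factor over `p` occurs in every factorization
(`mem_of_filter_eq_singleton`); in either case a common factor can be cancelled. A nonregular
element has exactly one factor `ε`, in whose presence only diagonal entries matter, so that all
factorizations can be refined to the prime factorization in `D` (`exists_linked_eps_primes`).

*Lower bounds.* The element `(p ^ 4, 0) = (p ^ 2, 1) (p ^ 2, -1) = (p, 0) ^ 4` has no factorization
of length `3` (`three_notMem_lengthSet_pow_four`), and a factorization of length `2` shares no factor
with a longer one.

*Local tameness.* A product of `2 * k + 1` irreducible elements over `p` is divisible by
`(p ^ (2 * k), 0)` and hence by `(p ^ k, y)`, so that a bounded part of any factorization suffices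
to produce this factor (`exists_le_prod_le`); the cofactor has a power of `p` on the diagonal, and
such elements have factorizations of length at most `4` (`hasShortFactorization`).
-/

namespace SelfIdeal

section Elements

/-! ### Elements of the self-idealization -/

variable {D : Type*} [CommRing D]

/-- The element `(a b; 0 a)` of `R(D)`, thought of as `a + b ε` with `ε² = 0`. -/
def pair (a b : D) : selfIdealization D := ⟨!![a, b; 0, a], a, b, rfl⟩

lemma exists_eq_pair (r : selfIdealization D) : ∃ a b, r = pair a b := by
  obtain ⟨_, a, b, rfl⟩ := r
  exact ⟨a, b, rfl⟩

lemma pair_inj {a b c d : D} : pair a b = pair c d ↔ a = c ∧ b = d := by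
  constructor
  · intro h
    have h' : !![a, b; 0, a] = !![c, d; 0, c] := congrArg Subtype.val h
    exact ⟨by simpa using congrFun (congrFun h' 0) 0, by simpa using congrFun (congrFun h' 0) 1⟩
  · rintro ⟨rfl, rfl⟩
    rfl

lemma pair_mul (a b c d : D) : pair a b * pair c d = pair (a * c) (a * d + b * c) := by
  apply Subtype.ext
  change !![a, b; 0, a] * !![c, d; 0, c] = !![a * c, a * d + b * c; 0, a * c]
  simp

lemma pair_add (a b c d : D) : pair a b + pair c d = pair (a + c) (b + d) := by
  apply Subtype.ext
  change !![a, b; 0, a] + !![c, d; 0, c] = !![a + c, b + d; 0, a + c]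
  simp

lemma pair_one : (pair 1 0 : selfIdealization D) = 1 := by
  apply Subtype.ext
  change !![(1 : D), 0; 0, 1] = 1
  simp [Matrix.one_fin_two]

lemma pair_zero : (pair 0 0 : selfIdealization D) = 0 := by
  apply Subtype.ext
  change !![(0 : D), 0; 0, 0] = 0
  ext i j; fin_cases i <;> fin_cases j <;> rfl

/-- The projection `R(D) → D` onto the diagonal entry. -/
def fst : selfIdealization D →+* D where
  toFun r := r.1 0 0
  map_one' := by rw [← pair_one]; simp [pair]
  map_zero' := by rw [← pair_zero]; simp [pair]
  map_mul' x y := by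
    obtain ⟨a, b, rfl⟩ := exists_eq_pair x
    obtain ⟨c, d, rfl⟩ := exists_eq_pair y
    rw [pair_mul]
    simp [pair]
  map_add' x y := by
    obtain ⟨a, b, rfl⟩ := exists_eq_pair x
    obtain ⟨c, d, rfl⟩ := exists_eq_pair y
    rw [pair_add]
    simp [pair]

@[simp] lemma fst_pair (a b : D) : fst (pair a b) = a := by
  simp [fst, pair]

lemma pair_pow_zero (a : D) (n : ℕ) : pair a 0 ^ n = pair (a ^ n) 0 := by
  induction n with
  | zero => simp [pair_one]
  | succ n ih => rw [pow_succ, ih, pair_mul, pow_succ]; simp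

lemma isUnit_iff (r : selfIdealization D) : IsUnit r ↔ IsUnit (fst r) := by
  refine ⟨fun h => h.map fst, fun h => ?_⟩
  obtain ⟨a, b, rfl⟩ := exists_eq_pair r
  rw [fst_pair] at h
  obtain ⟨c, hc⟩ := h.exists_right_inv
  refine IsUnit.of_mul_eq_one (pair c (-(b * c * c))) ?_
  rw [pair_mul, ← pair_one, pair_inj]
  exact ⟨hc, by linear_combination (-b * c) * hc⟩

lemma isUnit_pair {a b : D} : IsUnit (pair a b) ↔ IsUnit a := by
  rw [isUnit_iff, fst_pair]

lemma mul_cancel_of_fst_ne_zero [IsDomain D] {r s t : selfIdealization D} (hr : fst r ≠ 0)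
    (h : r * s = r * t) : s = t := by
  obtain ⟨a, b, rfl⟩ := exists_eq_pair r
  obtain ⟨c, d, rfl⟩ := exists_eq_pair s
  obtain ⟨e, f, rfl⟩ := exists_eq_pair t
  rw [fst_pair] at hr
  rw [pair_mul, pair_mul, pair_inj] at h
  obtain ⟨h1, h2⟩ := h
  obtain rfl : c = e := mul_left_cancel₀ hr h1
  rw [pair_inj]
  exact ⟨rfl, mul_left_cancel₀ hr (add_right_cancel h2)⟩

/-- All zero-divisors of `R(D)` are nilpotent, so that elements generating the same ideal differ
by a unit. -/
lemma areAssociates_iff [IsDomain D] {r s : selfIdealization D} :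
    AreAssociates r s ↔ Associated r s := by
  constructor
  · intro h
    have h1 : s ∣ r := Ideal.span_singleton_le_span_singleton.mp h.le
    have h2 : r ∣ s := Ideal.span_singleton_le_span_singleton.mp h.ge
    obtain ⟨t, ht⟩ := h2
    obtain ⟨w, hw⟩ := h1
    by_cases hr : r = 0
    · subst hr; simp at ht; subst ht; exact Associated.refl _
    have htw : IsUnit t := by
      rw [isUnit_iff]
      have hmul : r * (t * w) = r := by rw [← mul_assoc, ← ht, ← hw]
      obtain ⟨a, b, rfl⟩ := exists_eq_pair r
      obtain ⟨c, d, hcd⟩ := exists_eq_pair (t * w)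
      have hc : c = 1 := by
        rw [hcd, pair_mul, pair_inj] at hmul
        by_cases ha : a = 0
        · subst ha
          have hb : b ≠ 0 := by rintro rfl; exact hr pair_zero
          exact mul_left_cancel₀ hb (by simpa using hmul.2)
        · exact mul_left_cancel₀ ha (by simpa using hmul.1)
      refine IsUnit.of_mul_eq_one (fst w) ?_
      rw [← map_mul, hcd, fst_pair, hc]
    exact ⟨htw.unit, by simpa using ht.symm⟩
  · rintro ⟨u, rfl⟩
    exact (Ideal.span_singleton_mul_right_unit u.isUnit r).symm

lemma span_eq_iff [IsDomain D] {r s : selfIdealization D} :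
    Ideal.span {r} = Ideal.span {s} ↔ Associated r s := areAssociates_iff

lemma IsAtomElt.of_associated [IsDomain D] {r s : selfIdealization D} (h : Associated r s)
    (hr : IsAtomElt r) : IsAtomElt s := by
  refine ⟨fun hs => hr.1 (h.isUnit_iff.mpr hs), fun b c hbc => ?_⟩
  obtain ⟨u, hu⟩ := h.symm
  have hsr := areAssociates_iff.mpr h
  rcases hr.2 b (c * u) (by rw [← mul_assoc, ← hbc, hu]) with h1 | h1
  · exact Or.inl (h1.trans hsr)
  · refine Or.inr (Eq.trans ?_ (h1.trans hsr))
    exact (Ideal.span_singleton_mul_right_unit u.isUnit c).symm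

/-- A regular irreducible element is irreducible in the usual sense. -/
lemma IsAtomElt.isUnit_or_isUnit [IsDomain D] {r b c : selfIdealization D} (hr : IsAtomElt r)
    (h0 : fst r ≠ 0) (h : r = b * c) : IsUnit b ∨ IsUnit c := by
  have hb : fst b ≠ 0 := by rintro hb; apply h0; rw [h, map_mul, hb, zero_mul]
  have hc : fst c ≠ 0 := by rintro hb; apply h0; rw [h, map_mul, hb, mul_zero]
  rcases hr.2 b c h with h1 | h1
  · obtain ⟨u, hu⟩ := areAssociates_iff.mp h1
    right
    rw [mul_cancel_of_fst_ne_zero hb (hu.trans h).symm]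
    exact u.isUnit
  · obtain ⟨u, hu⟩ := areAssociates_iff.mp h1
    left
    rw [mul_cancel_of_fst_ne_zero hc ((hu.trans h).trans (mul_comm b c)).symm]
    exact u.isUnit

lemma isAtomElt_of_forall_isUnit {r : selfIdealization D} (hr : ¬ IsUnit r)
    (h : ∀ b c, r = b * c → IsUnit b ∨ IsUnit c) : IsAtomElt r := by
  refine ⟨hr, fun b c hbc => ?_⟩
  rcases h b c hbc with hu | hu
  · right
    change Ideal.span {c} = Ideal.span {r}
    rw [hbc, Ideal.span_singleton_mul_left_unit hu]
  · left
    change Ideal.span {b} = Ideal.span {r}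
    rw [hbc, Ideal.span_singleton_mul_right_unit hu]

/-! ### Irreducible elements -/

lemma isAtomElt_eps [IsDomain D] : IsAtomElt (pair 0 1 : selfIdealization D) := by
  refine isAtomElt_of_forall_isUnit (by rw [isUnit_pair]; exact not_isUnit_zero) ?_
  intro r s h
  obtain ⟨a, b, rfl⟩ := exists_eq_pair r
  obtain ⟨c, d, rfl⟩ := exists_eq_pair s
  rw [pair_mul, pair_inj] at h
  rw [isUnit_pair, isUnit_pair]
  rcases mul_eq_zero.mp h.1.symm with rfl | rfl
  · right; exact IsUnit.of_mul_eq_one b (by linear_combination -h.2)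
  · left; exact IsUnit.of_mul_eq_one d (by linear_combination -h.2)

lemma isAtomElt_pair_pow [IsDomain D] {p y : D} (hp : Prime p) {k : ℕ} (hk : 1 ≤ k)
    (h : k = 1 ∨ ¬ p ∣ y) : IsAtomElt (pair (p ^ k) y) := by
  refine isAtomElt_of_forall_isUnit ?_ ?_
  · rw [isUnit_pair]
    exact fun hu => hp.not_isUnit ((isUnit_pow_iff (by omega)).mp hu)
  intro r s hrs
  obtain ⟨a, b, rfl⟩ := exists_eq_pair r
  obtain ⟨c, d, rfl⟩ := exists_eq_pair s
  rw [pair_mul, pair_inj] at hrs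
  rw [isUnit_pair, isUnit_pair]
  rcases h with rfl | h
  · exact hp.irreducible.isUnit_or_isUnit (by simpa using hrs.1)
  · by_contra! hcon
    have hpa : ∀ a c : D, p ^ k = a * c → ¬ IsUnit a → p ∣ a := by
      intro a c hac hna
      obtain ⟨i, -, hi⟩ := (dvd_prime_pow hp k).mp (Dvd.intro _ hac.symm)
      rcases Nat.eq_zero_or_pos i with rfl | hi0
      · exact absurd (hi.isUnit_iff.mpr (by simp)) hna
      · exact (dvd_pow_self p (by omega)).trans hi.symm.dvd
    have h1 := hpa a c hrs.1 hcon.1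
    have h2 := hpa c a (by rw [hrs.1, mul_comm]) hcon.2
    exact h (hrs.2 ▸ dvd_add (h1.mul_right d) (h2.mul_left b))

lemma associated_eps {b : D} (hb : IsUnit b) : Associated (pair 0 b) (pair 0 1) := by
  obtain ⟨c, hc⟩ := hb.exists_right_inv
  have hu : IsUnit (pair c 0) := isUnit_pair.mpr (IsUnit.of_mul_eq_one_right b hc)
  refine ⟨hu.unit, ?_⟩
  rw [IsUnit.unit_spec, pair_mul, pair_inj]
  simp [hc]

section PID

variable [IsDomain D] [IsPrincipalIdealRing D]

/-- The classification of the irreducible elements of `R(D)`. -/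
lemma IsAtomElt.classify {r : selfIdealization D} (hr : IsAtomElt r) :
    Associated r (pair 0 1) ∨ ∃ (p : D) (k : ℕ) (y : D), Prime p ∧ 1 ≤ k ∧ (k = 1 ∨ ¬ p ∣ y) ∧
      Associated r (pair (p ^ k) y) := by
  obtain ⟨a, b, rfl⟩ := exists_eq_pair r
  by_cases ha : a = 0
  · left
    subst ha
    have h := hr.2 (pair 0 1) (pair b 0) (by rw [pair_mul, pair_inj]; simp)
    rw [areAssociates_iff, areAssociates_iff] at h
    rcases h with h | ⟨u, hu⟩
    · exact h.symm
    · -- `(b, 0)` can be a multiple of `(0, b)` only if `b = 0`, and `0 = ε * ε` is not irreducible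
      have hb : b = 0 := by
        obtain ⟨c, d, hcd⟩ := exists_eq_pair (u⁻¹ : (selfIdealization D)ˣ).1
        have : pair b 0 = pair 0 b * pair c d := by rw [← hcd, ← hu]; simp
        rw [pair_mul, pair_inj] at this
        simpa using this.1
      subst hb
      have h := hr.2 (pair 0 1) (pair 0 1) (by rw [pair_mul, pair_inj]; simp)
      rw [or_self, areAssociates_iff] at h
      exact h.symm
  · right
    have hna : ¬ IsUnit a := fun h => hr.1 (isUnit_pair.mpr h)
    obtain ⟨p, hpi, hpa⟩ := WfDvdMonoid.exists_irreducible_factor hna ha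
    have hp := hpi.prime
    obtain ⟨k, c, hpc, rfl⟩ := WfDvdMonoid.max_power_factor ha hpi
    have hk : 1 ≤ k := by
      by_contra hk
      obtain rfl : k = 0 := by omega
      exact hpc (by simpa using hpa)
    have hcop : IsCoprime (p ^ k) c := by
      apply IsCoprime.pow_left
      exact (hpi.coprime_iff_not_dvd).mpr hpc
    obtain ⟨x, y, hxy⟩ := hcop
    have hfac : pair (p ^ k * c) b = pair (p ^ k) (y * b) * pair c (x * b) := by
      rw [pair_mul, pair_inj]
      exact ⟨rfl, by linear_combination (-b) * hxy⟩
    have h0 : fst (pair (p ^ k * c) b) ≠ 0 := by simpa using ha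
    have hcu : IsUnit (pair c (x * b)) := by
      refine (hr.isUnit_or_isUnit h0 hfac).resolve_left ?_
      rw [isUnit_pair]
      exact fun hu => hp.not_isUnit ((isUnit_pow_iff (by omega)).mp hu)
    have hassoc : Associated (pair (p ^ k * c) b) (pair (p ^ k) (y * b)) := by
      rw [hfac]
      exact (associated_mul_unit_left _ _ hcu)
    refine ⟨p, k, y * b, hp, hk, ?_, hassoc⟩
    by_contra! hcon
    obtain ⟨hk1, w, hw⟩ := hcon
    have hr' := hr.of_associated hassoc
    have := hr'.isUnit_or_isUnit (b := pair p 0) (c := pair (p ^ (k - 1)) w)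
      (by simpa using pow_ne_zero k hp.ne_zero)
      (by rw [pair_mul, pair_inj, ← pow_succ', hw]; exact ⟨by congr 1; omega, by ring⟩)
    rw [isUnit_pair, isUnit_pair, isUnit_pow_iff (by omega)] at this
    exact hp.not_isUnit (by simpa using this)

/-- `R(D)` is atomic. -/
lemma isAtomicRing : IsAtomicRing (selfIdealization D) := by
  have key : ∀ a : D, a ≠ 0 → ∀ b, ¬ IsUnit (pair a b) →
      ∃ s : Multiset (selfIdealization D), (∀ u ∈ s, IsAtomElt u) ∧ s.prod = pair a b := by
    intro a
    induction a using (wellFounded_dvdNotUnit (α := D)).induction with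
    | _ a ih =>
    intro ha b hb
    by_cases hat : IsAtomElt (pair a b)
    · exact ⟨{pair a b}, by simpa using hat, by simp⟩
    have hex : ∃ r s, pair a b = r * s ∧ ¬ IsUnit r ∧ ¬ IsUnit s := by
      by_contra! hcon
      refine hat (isAtomElt_of_forall_isUnit hb fun r s hrs => ?_)
      by_contra! h
      exact h.2 (hcon r s hrs h.1)
    obtain ⟨r, s, hrs, hr, hs⟩ := hex
    obtain ⟨c, d, rfl⟩ := exists_eq_pair r
    obtain ⟨e, f, rfl⟩ := exists_eq_pair s
    have h1 := hrs
    rw [pair_mul, pair_inj] at h1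
    obtain ⟨rfl, -⟩ := h1
    have hc := left_ne_zero_of_mul ha
    have he := right_ne_zero_of_mul ha
    rw [isUnit_pair] at hr hs
    obtain ⟨s1, hs1, hp1⟩ := ih c ⟨hc, e, hs, rfl⟩ hc d (by rwa [isUnit_pair])
    obtain ⟨s2, hs2, hp2⟩ := ih e ⟨he, c, hr, mul_comm c e⟩ he f (by rwa [isUnit_pair])
    refine ⟨s1 + s2, ?_, by rw [Multiset.prod_add, hp1, hp2, hrs]⟩
    intro u hu
    rcases Multiset.mem_add.mp hu with h | h
    exacts [hs1 u h, hs2 u h]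
  intro r hr0 hr
  obtain ⟨a, b, rfl⟩ := exists_eq_pair r
  by_cases ha : a = 0
  · subst ha
    have hb : b ≠ 0 := by rintro rfl; exact hr0 pair_zero
    by_cases hbu : IsUnit b
    · exact ⟨{pair 0 b}, by simpa using isAtomElt_eps.of_associated (associated_eps hbu).symm,
        by simp⟩
    · obtain ⟨s, hs, hsp⟩ := key b hb 0 (by rwa [isUnit_pair])
      refine ⟨pair 0 1 ::ₘ s, ?_, ?_⟩
      · intro u hu
        rcases Multiset.mem_cons.mp hu with rfl | h
        exacts [isAtomElt_eps, hs u h]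
      · rw [Multiset.prod_cons, hsp, pair_mul, pair_inj]
        simp
  · exact key a ha b hr

end PID

end Elements

section Factorizations

/-! ### Factorizations as multisets of principal ideals -/

section General

variable {R : Type*} [CommRing R]

/-- A principal ideal generated by an irreducible element, i.e. a class of associated irreducible
elements. -/
def IsAtomIdeal (I : Ideal R) : Prop := ∃ u, IsAtomElt u ∧ I = Ideal.span {u}

/-- `z` is a factorization of the ideal `J` into ideals generated by irreducible elements. For
`J = aR` with `a` a nonunit of `R(D)` these are the factorizations of `a`. -/
def IsFactorization (z : Multiset (Ideal R)) (J : Ideal R) : Prop :=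
  (∀ I ∈ z, IsAtomIdeal I) ∧ z.prod = J

lemma IsAtomIdeal.ne_top {I : Ideal R} (h : IsAtomIdeal I) : I ≠ ⊤ := by
  obtain ⟨u, hu, rfl⟩ := h
  rw [Ne, Ideal.span_singleton_eq_top]
  exact hu.1

lemma multiset_prod_le_of_mem {z : Multiset (Ideal R)} {I : Ideal R} (h : I ∈ z) :
    z.prod ≤ I := Ideal.le_of_dvd (Multiset.dvd_prod h)

lemma IsFactorization.eq_zero {z : Multiset (Ideal R)} (h : IsFactorization z ⊤) : z = 0 := by
  refine Multiset.eq_zero_of_forall_notMem fun I hI => (h.1 I hI).ne_top ?_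
  rw [eq_top_iff, ← h.2]
  exact multiset_prod_le_of_mem hI

lemma factDist_le_max_card (x y : Multiset (Ideal R)) :
    factDist x y ≤ max (Multiset.card x) (Multiset.card y) := by
  classical
  unfold factDist
  exact max_le_max (Multiset.card_le_card (Multiset.sub_le_self _ _))
    (Multiset.card_le_card (Multiset.sub_le_self _ _))

lemma factDist_add_right (x y c : Multiset (Ideal R)) :
    factDist (x + c) (y + c) = factDist x y := by
  classical
  unfold factDist
  rw [add_tsub_add_eq_tsub_right, add_tsub_add_eq_tsub_right]

lemma factDist_comm (x y : Multiset (Ideal R)) : factDist x y = factDist y x := max_comm _ _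

/-- An elementary step between two factorizations of the same ideal: it has distance at most `4`
and changes the length by at most `2`. -/
def Step (x y : Multiset (Ideal R)) : Prop :=
  (∀ I ∈ x, IsAtomIdeal I) ∧ (∀ I ∈ y, IsAtomIdeal I) ∧ x.prod = y.prod ∧ factDist x y ≤ 4 ∧
    Multiset.card x ≤ Multiset.card y + 2 ∧ Multiset.card y ≤ Multiset.card x + 2

lemma Step.symm {x y : Multiset (Ideal R)} (h : Step x y) : Step y x :=
  ⟨h.2.1, h.1, h.2.2.1.symm, factDist_comm x y ▸ h.2.2.2.1, h.2.2.2.2.2, h.2.2.2.2.1⟩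

lemma Step.add_right {x y c : Multiset (Ideal R)} (h : Step x y) (hc : ∀ I ∈ c, IsAtomIdeal I) :
    Step (x + c) (y + c) := by
  refine ⟨fun I hI => ?_, fun I hI => ?_, ?_, ?_, ?_, ?_⟩
  · rcases Multiset.mem_add.mp hI with hI | hI
    exacts [h.1 I hI, hc I hI]
  · rcases Multiset.mem_add.mp hI with hI | hI
    exacts [h.2.1 I hI, hc I hI]
  · rw [Multiset.prod_add, Multiset.prod_add, h.2.2.1]
  · rw [factDist_add_right]; exact h.2.2.2.1
  · have := h.2.2.2.2.1
    simp only [Multiset.card_add]; omega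
  · have := h.2.2.2.2.2
    simp only [Multiset.card_add]; omega

lemma step_of_card_le {x y : Multiset (Ideal R)} (hx : ∀ I ∈ x, IsAtomIdeal I)
    (hy : ∀ I ∈ y, IsAtomIdeal I) (h : x.prod = y.prod) (h4x : Multiset.card x ≤ 4)
    (h4y : Multiset.card y ≤ 4) (hxy : Multiset.card x ≤ Multiset.card y + 2)
    (hyx : Multiset.card y ≤ Multiset.card x + 2) : Step x y :=
  ⟨hx, hy, h, (factDist_le_max_card x y).trans (max_le h4x h4y), hxy, hyx⟩

/-- Two factorizations are linked if they are joined by a chain of elementary steps. -/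
def Linked : Multiset (Ideal R) → Multiset (Ideal R) → Prop := Relation.ReflTransGen Step

lemma Linked.symm {x y : Multiset (Ideal R)} (h : Linked x y) : Linked y x := by
  have : Std.Symm (Step (R := R)) := ⟨fun _ _ => Step.symm⟩
  exact Relation.ReflTransGen.stdSymm.symm _ _ h

lemma Linked.add_right {x y c : Multiset (Ideal R)} (h : Linked x y)
    (hc : ∀ I ∈ c, IsAtomIdeal I) : Linked (x + c) (y + c) :=
  Relation.ReflTransGen.lift (· + c) (fun _ _ hs => Step.add_right hs hc) _ _ h

lemma Linked.isFactorization {x y : Multiset (Ideal R)} {J : Ideal R} (h : Linked x y)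
    (hx : IsFactorization x J) : IsFactorization y J := by
  induction h with
  | refl => exact hx
  | tail _ hs ih => exact ⟨hs.2.1, hs.2.2.1.symm.trans ih.2⟩

lemma exists_span_of_forall_isAtomIdeal {z : Multiset (Ideal R)} (hz : ∀ I ∈ z, IsAtomIdeal I) :
    ∃ r, z.prod = Ideal.span {r} := by
  induction z using Multiset.induction with
  | empty => exact ⟨1, by simp⟩
  | cons I z ih =>
    obtain ⟨u, -, hu⟩ := hz I (Multiset.mem_cons_self I z)
    obtain ⟨r, hr⟩ := ih fun J hJ => hz J (Multiset.mem_cons_of_mem hJ)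
    exact ⟨u * r, by rw [Multiset.prod_cons, hu, hr, Ideal.span_singleton_mul_span_singleton]⟩

end General

variable {D : Type*} [CommRing D] [IsDomain D]

lemma mem_factorizations_iff {a : selfIdealization D} (ha : ¬ IsUnit a)
    {z : Multiset (Ideal (selfIdealization D))} :
    z ∈ factorizations a ↔ IsFactorization z (Ideal.span {a}) := by
  constructor
  · rintro ⟨s, hs, rfl, rfl⟩
    refine ⟨fun I hI => ?_, Ideal.multiset_prod_span_singleton s⟩
    obtain ⟨u, hu, rfl⟩ := Multiset.mem_map.mp hI
    exact ⟨u, hs u hu, rfl⟩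
  · rintro ⟨hz, hp⟩
    have hlift : ∃ s : Multiset (selfIdealization D), (∀ u ∈ s, IsAtomElt u) ∧
        z = s.map (fun u => Ideal.span {u}) := by
      clear hp
      induction z using Multiset.induction with
      | empty => exact ⟨0, by simp, by simp⟩
      | cons I z ih =>
        obtain ⟨u, hu, rfl⟩ := hz I (Multiset.mem_cons_self I z)
        obtain ⟨s, hs, rfl⟩ := ih fun J hJ => hz J (Multiset.mem_cons_of_mem hJ)
        exact ⟨u ::ₘ s, Multiset.forall_mem_cons.mpr ⟨hu, hs⟩, by simp⟩
    obtain ⟨s, hs, rfl⟩ := hlift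
    rw [Ideal.multiset_prod_span_singleton, span_eq_iff] at hp
    -- the product is only associated to `a`; the missing unit is absorbed by one of the factors
    induction s using Multiset.induction with
    | empty => exact absurd (hp.isUnit (by simp)) ha
    | cons u s _ =>
      obtain ⟨e, he⟩ := hp
      have hue : Associated u (u * e) := ⟨e, rfl⟩
      refine ⟨(u * e) ::ₘ s, ?_, ?_, ?_⟩
      · intro v hv
        rcases Multiset.mem_cons.mp hv with rfl | hv
        · exact (hs u (Multiset.mem_cons_self u s)).of_associated hue
        · exact hs v (Multiset.mem_cons_of_mem hv)
      · rw [← he, Multiset.prod_cons, Multiset.prod_cons]; ring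
      · rw [Multiset.map_cons, Multiset.map_cons, span_eq_iff.mpr hue]

/-- The class of the irreducible element `ε`. -/
def epsIdeal (D : Type*) [CommRing D] : Ideal (selfIdealization D) := Ideal.span {pair 0 1}

/-- `I` is the class of an irreducible element whose diagonal entry is a power of `p`. -/
def IsAtomAt (p : D) (I : Ideal (selfIdealization D)) : Prop :=
  ∃ (k : ℕ) (y : D), 1 ≤ k ∧ (k = 1 ∨ ¬ p ∣ y) ∧ I = Ideal.span {pair (p ^ k) y}

/-- The ideal of all elements of `R(D)` whose diagonal entry is divisible by `p`. -/
def primeAbove (p : D) : Ideal (selfIdealization D) := (Ideal.span {p}).comap fst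

lemma isAtomIdeal_epsIdeal : IsAtomIdeal (epsIdeal D) := ⟨_, isAtomElt_eps, rfl⟩

lemma IsAtomAt.isAtomIdeal {p : D} (hp : Prime p) {I : Ideal (selfIdealization D)}
    (h : IsAtomAt p I) : IsAtomIdeal I := by
  obtain ⟨k, y, hk, hy, rfl⟩ := h
  exact ⟨_, isAtomElt_pair_pow hp hk hy, rfl⟩

omit [IsDomain D] in
lemma isAtomAt_span_pow {p y : D} {k : ℕ} (hk : 1 ≤ k) (hy : ¬ p ∣ y) :
    IsAtomAt p (Ideal.span {pair (p ^ k) y}) := ⟨k, y, hk, Or.inr hy, rfl⟩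

omit [IsDomain D] in
lemma isAtomAt_span (p y : D) : IsAtomAt p (Ideal.span {pair p y}) :=
  ⟨1, y, le_rfl, Or.inl rfl, by rw [pow_one]⟩

omit [IsDomain D] in
lemma span_le_primeAbove {p a b : D} : Ideal.span {pair a b} ≤ primeAbove p ↔ p ∣ a := by
  rw [Ideal.span_singleton_le_iff_mem, primeAbove, Ideal.mem_comap, fst_pair,
    Ideal.mem_span_singleton]

omit [IsDomain D] in
lemma primeAbove_isPrime {p : D} (hp : Prime p) : (primeAbove p).IsPrime := by
  have := (Ideal.span_singleton_prime hp.ne_zero).mpr hp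
  exact Ideal.comap_isPrime _ _

lemma fst_ne_zero_of_span_eq {r s : selfIdealization D} (h : Ideal.span {r} = Ideal.span {s})
    (hr : fst r ≠ 0) : fst s ≠ 0 := by
  have := (span_eq_iff.mp h).map (fst : selfIdealization D →+* D)
  exact fun hs => hr (by rwa [hs, associated_zero_iff_eq_zero] at this)

omit [IsDomain D] in
lemma epsIdeal_mul_span (a b : D) :
    epsIdeal D * Ideal.span {pair a b} = Ideal.span {pair 0 a} := by
  rw [epsIdeal, Ideal.span_singleton_mul_span_singleton, pair_mul]; simp

/-- Multiplication by a regular principal ideal is injective. -/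
lemma span_mul_cancel {r : selfIdealization D} (hr : fst r ≠ 0)
    {A B : Ideal (selfIdealization D)} (h : Ideal.span {r} * A = Ideal.span {r} * B) : A = B := by
  have key : ∀ {A B : Ideal (selfIdealization D)},
      Ideal.span {r} * A = Ideal.span {r} * B → A ≤ B := by
    intro A B h x hx
    have hm : r * x ∈ Ideal.span {r} * B := by
      rw [← h]; exact Ideal.mul_mem_mul (Ideal.mem_span_singleton_self r) hx
    obtain ⟨y, hy, hxy⟩ := Ideal.mem_span_singleton_mul.mp hm
    rwa [← mul_cancel_of_fst_ne_zero hr hxy]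
  exact le_antisymm (key h) (key h.symm)

omit [IsDomain D] in
/-- Factorizations of a regular element do not involve `ε`. -/
lemma epsIdeal_notMem {z : Multiset (Ideal (selfIdealization D))} {a b : D} (ha : a ≠ 0)
    (hz : z.prod = Ideal.span {pair a b}) : epsIdeal D ∉ z := by
  intro he
  have h := hz ▸ multiset_prod_le_of_mem he
  rw [epsIdeal, Ideal.span_singleton_le_span_singleton] at h
  have := map_dvd (fst : selfIdealization D →+* D) h
  rw [fst_pair, fst_pair, zero_dvd_iff] at this
  exact ha this

/-- A regular irreducible element has no factorization but the trivial one. -/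
lemma eq_singleton_of_prod_eq {u : selfIdealization D} (hu : IsAtomElt u) (h0 : fst u ≠ 0)
    {z : Multiset (Ideal (selfIdealization D))} (hz : ∀ I ∈ z, IsAtomIdeal I)
    (h : z.prod = Ideal.span {u}) : z = {Ideal.span {u}} := by
  rcases Multiset.empty_or_exists_mem z with rfl | ⟨J, hJ⟩
  · rw [Multiset.prod_zero, Ideal.one_eq_top, eq_comm, Ideal.span_singleton_eq_top] at h
    exact absurd h hu.1
  obtain ⟨t, rfl⟩ := Multiset.exists_cons_of_mem hJ
  have ht : ∀ L ∈ t, IsAtomIdeal L := fun L hL => hz L (Multiset.mem_cons_of_mem hL)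
  obtain ⟨r, hr⟩ := exists_span_of_forall_isAtomIdeal ht
  obtain ⟨v, hv, rfl⟩ := hz J hJ
  rw [Multiset.prod_cons, hr, Ideal.span_singleton_mul_span_singleton, span_eq_iff] at h
  have hr1 : IsUnit r := ((hu.of_associated h.symm).isUnit_or_isUnit (fst_ne_zero_of_span_eq
    (span_eq_iff.mpr h.symm) h0) rfl).resolve_left hv.1
  have ht0 : t = 0 := IsFactorization.eq_zero ⟨ht, by rw [hr, Ideal.span_singleton_eq_top.mpr hr1]⟩
  rw [ht0, span_eq_iff.mpr ((associated_mul_unit_right v r hr1).trans h)]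
  rfl

omit [IsDomain D] in
/-- A product of `m` irreducible elements with powers of `p` on the diagonal lies in the `m`-th
power of the ideal `(p, ε)`, which consists of the `(a, b)` with `p ^ m ∣ a` and
`p ^ (m - 1) ∣ b`. -/
lemma prod_eq_of_forall_isAtomAt {p : D} {z : Multiset (Ideal (selfIdealization D))}
    (hz : ∀ I ∈ z, IsAtomAt p I) :
    ∃ n b, Multiset.card z ≤ n ∧ p ^ (Multiset.card z - 1) ∣ b ∧
      z.prod = Ideal.span {pair (p ^ n) b} := by
  induction z using Multiset.induction with
  | empty => exact ⟨0, 0, by simp, by simp, by simp [pair_one]⟩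
  | cons I z ih =>
    obtain ⟨k, y, hk, -, rfl⟩ := hz I (Multiset.mem_cons_self I z)
    obtain ⟨n, b, hn, hpb, hb⟩ := ih fun J hJ => hz J (Multiset.mem_cons_of_mem hJ)
    refine ⟨k + n, p ^ k * b + y * p ^ n, ?_, ?_, ?_⟩
    · rw [Multiset.card_cons]; omega
    · rw [Multiset.card_cons, Nat.add_sub_cancel]
      refine dvd_add ?_ ((pow_dvd_pow p hn).mul_left y)
      refine dvd_trans ?_ (mul_dvd_mul (pow_dvd_pow p hk) hpb)
      rw [← pow_add]
      exact pow_dvd_pow p (by omega)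
    · rw [Multiset.prod_cons, hb, Ideal.span_singleton_mul_span_singleton, pair_mul, pow_add]

section PID

variable [IsPrincipalIdealRing D]

lemma IsAtomIdeal.classify {I : Ideal (selfIdealization D)} (h : IsAtomIdeal I)
    (he : I ≠ epsIdeal D) : ∃ p, Prime p ∧ IsAtomAt p I := by
  obtain ⟨u, hu, rfl⟩ := h
  rcases hu.classify with h | ⟨p, k, y, hp, hk, hy, h⟩
  · exact absurd (span_eq_iff.mpr h) he
  · exact ⟨p, hp, k, y, hk, hy, span_eq_iff.mpr h⟩

lemma IsAtomIdeal.isAtomAt {I : Ideal (selfIdealization D)} (h : IsAtomIdeal I)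
    (he : I ≠ epsIdeal D) {p : D} (hp : Prime p) (hI : I ≤ primeAbove p) : IsAtomAt p I := by
  obtain ⟨q, hq, k, y, hk, hy, rfl⟩ := h.classify he
  have hpq : Associated q p :=
    (hp.associated_of_dvd hq (hp.dvd_of_dvd_pow (span_le_primeAbove.mp hI))).symm
  obtain ⟨u, hu⟩ := hpq
  refine ⟨k, y * (u : D) ^ k, hk, hy.imp_right fun hy => ?_, ?_⟩
  · intro hpy
    refine hy ?_
    rw [← hu] at hpy
    exact ((u.isUnit.pow k).dvd_mul_right).mp ((dvd_mul_right q u).trans hpy)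
  · have hun : IsUnit (pair ((u : D) ^ k) 0) := isUnit_pair.mpr (u.isUnit.pow k)
    rw [← Ideal.span_singleton_mul_right_unit hun, pair_mul, ← hu, mul_pow]
    simp

lemma prod_eq_span_of_regular {z : Multiset (Ideal (selfIdealization D))}
    (hz : ∀ I ∈ z, IsAtomIdeal I) (he : epsIdeal D ∉ z) :
    ∃ a b, a ≠ 0 ∧ z.prod = Ideal.span {pair a b} := by
  induction z using Multiset.induction with
  | empty => exact ⟨1, 0, one_ne_zero, by simp [pair_one]⟩
  | cons I z ih =>
    obtain ⟨a, b, ha, hb⟩ := ih (fun J hJ => hz J (Multiset.mem_cons_of_mem hJ))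
      (fun h => he (Multiset.mem_cons_of_mem h))
    obtain ⟨p, hp, k, y, hk, -, rfl⟩ := (hz I (Multiset.mem_cons_self I z)).classify
      (fun h => he (h ▸ Multiset.mem_cons_self I z))
    exact ⟨p ^ k * a, p ^ k * b + y * a, mul_ne_zero (pow_ne_zero k hp.ne_zero) ha, by
      rw [Multiset.prod_cons, hb, Ideal.span_singleton_mul_span_singleton, pair_mul]⟩

omit [IsDomain D] [IsPrincipalIdealRing D] in
open Classical in
/-- The product of the factors of a factorization that are not over `p`. -/
lemma prod_filter_not_eq {z : Multiset (Ideal (selfIdealization D))} {p : D} (hp : Prime p)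
    (hz : ∀ I ∈ z, IsAtomIdeal I) :
    ∃ c d, ¬ p ∣ c ∧ (z.filter fun I => ¬ I ≤ primeAbove p).prod = Ideal.span {pair c d} := by
  obtain ⟨r, hr⟩ := exists_span_of_forall_isAtomIdeal
    (fun I hI => hz I (Multiset.mem_of_mem_filter hI) :
      ∀ I ∈ z.filter fun I => ¬ I ≤ primeAbove p, IsAtomIdeal I)
  obtain ⟨c, d, rfl⟩ := exists_eq_pair r
  refine ⟨c, d, fun hpc => ?_, hr⟩
  have h := span_le_primeAbove (b := d).mpr hpc
  rw [← hr, (primeAbove_isPrime hp).multiset_prod_le] at h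
  obtain ⟨I, hI, hle⟩ := h
  exact (Multiset.mem_filter.mp hI).2 hle

open Classical in
lemma forall_filter_isAtomAt {z : Multiset (Ideal (selfIdealization D))} {p : D} (hp : Prime p)
    (hz : ∀ I ∈ z, IsAtomIdeal I) (he : epsIdeal D ∉ z) :
    ∀ I ∈ z.filter (· ≤ primeAbove p), IsAtomAt p I := by
  intro I hI
  obtain ⟨hI, hle⟩ := Multiset.mem_filter.mp hI
  exact (hz I hI).isAtomAt (fun h => he (h ▸ hI)) hp hle

/-- Factors prime to `p` do not contribute to divisibility by an element with a power of `p` on the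
diagonal: multiplying `(c, d)` with its conjugate `(c, -d)` yields a scalar prime to `p`, which is
a unit modulo the multiple `(p ^ (2 * k), 0)` of `(p ^ k, y)`. -/
lemma pair_dvd_of_dvd_mul {p y c d : D} {k : ℕ} (hp : Prime p) (hc : ¬ p ∣ c)
    {r : selfIdealization D} (h : pair (p ^ k) y ∣ r * pair c d) : pair (p ^ k) y ∣ r := by
  have hcop : IsCoprime (c ^ 2) (p ^ (k + k)) := by
    apply IsCoprime.pow
    exact ((hp.irreducible.coprime_iff_not_dvd).mpr hc).symm
  obtain ⟨e, f, hef⟩ := hcop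
  have h1 : r = r * pair c d * (pair c (-d) * pair e 0) +
      pair (p ^ k) y * (pair (p ^ k) (-y) * pair f 0 * r) := by
    have h2 : pair c d * (pair c (-d) * pair e 0) +
        pair (p ^ k) y * (pair (p ^ k) (-y) * pair f 0) = 1 := by
      rw [pair_mul, pair_mul, pair_mul, pair_mul, pair_add, ← pair_one, pair_inj]
      exact ⟨by linear_combination hef, by ring⟩
    linear_combination (-r) * h2
  rw [h1]
  exact dvd_add (h.mul_right _) (dvd_mul_right _ _)

end PID

end Factorizations

section Linking

variable {D : Type*} [CommRing D] [IsDomain D]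

/-! ### Linking factorizations -/

section Pairs

variable {p : D}

lemma forall_mem_of_isAtomAt (hp : Prime p) {z : Multiset (Ideal (selfIdealization D))}
    (hz : ∀ I ∈ z, IsAtomAt p I) : ∀ I ∈ z, IsAtomIdeal I := fun I hI => (hz I hI).isAtomIdeal hp

/-- Any product of two irreducible elements over `p` is linked to a factorization that involves
`(p, 0)`. A single step suffices except for `(p ^ 3, y) (p ^ 3, w)` with `y + w` divisible by `p`
exactly once: if the residue field of `p` has two elements, then all factorizations of this product
of length at most `4` consist of two factors `(p ^ 3, *)` or three factors `(p ^ 2, *)`. -/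
lemma exists_linked_pair (hp : Prime p) {I J : Ideal (selfIdealization D)} (hI : IsAtomAt p I)
    (hJ : IsAtomAt p J) : ∃ w, Linked {I, J} (Ideal.span {pair p 0} ::ₘ w) := by
  have hIJ : ∀ {I J}, IsAtomAt p I → IsAtomAt p J →
      ∀ L ∈ ({I, J} : Multiset (Ideal (selfIdealization D))), IsAtomIdeal L := by
    intro I J hI hJ
    refine forall_mem_of_isAtomAt hp ?_
    simp only [Multiset.insert_eq_cons, Multiset.mem_cons, Multiset.mem_singleton]
    rintro L (rfl | rfl) <;> assumption
  have step : ∀ {I J} {z : Multiset (Ideal (selfIdealization D))}, IsAtomAt p I → IsAtomAt p J →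
      (∀ L ∈ z, IsAtomAt p L) → I * J = z.prod → 2 ≤ Multiset.card z → Multiset.card z ≤ 4 →
      Linked {I, J} z := by
    intro I J z hI hJ hz hprod h2 h4
    have hc : Multiset.card ({I, J} : Multiset (Ideal (selfIdealization D))) = 2 := rfl
    exact .single (step_of_card_le (hIJ hI hJ) (forall_mem_of_isAtomAt hp hz)
      (by simpa using hprod) (by omega) h4 (by omega) (by omega))
  -- the larger exponent may be assumed to come first
  suffices H : ∀ k y l w : _, l ≤ k → 1 ≤ l → (l = 1 ∨ ¬ p ∣ w) → (k = 1 ∨ ¬ p ∣ y) →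
      ∃ v, Linked {Ideal.span {pair (p ^ k) y}, Ideal.span {pair (p ^ l) w}}
        (Ideal.span {pair p 0} ::ₘ v) by
    obtain ⟨k, y, hk, hy, rfl⟩ := hI
    obtain ⟨l, w, hl, hw, rfl⟩ := hJ
    rcases le_total l k with h | h
    · exact H k y l w h hl hw hy
    · rw [Multiset.pair_comm]
      exact H l w k y h hk hy hw
  intro k y l w hlk hl hw hy
  have hIat : IsAtomAt p (Ideal.span {pair (p ^ k) y}) := ⟨k, y, hl.trans hlk, hy, rfl⟩
  have hJat : IsAtomAt p (Ideal.span {pair (p ^ l) w}) := ⟨l, w, hl, hw, rfl⟩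
  have hp1 : ¬ p ∣ 1 := fun h => hp.not_isUnit (isUnit_of_dvd_one h)
  have hπ := isAtomAt_span p 0
  have memcons : ∀ {I} {z : Multiset (Ideal (selfIdealization D))}, IsAtomAt p I →
      (∀ L ∈ z, IsAtomAt p L) → ∀ L ∈ I ::ₘ z, IsAtomAt p L :=
    fun h1 h2 => Multiset.forall_mem_cons.mpr ⟨h1, h2⟩
  have memnil : ∀ L ∈ (0 : Multiset (Ideal (selfIdealization D))), IsAtomAt p L := by simp
  obtain ⟨e, rfl⟩ := Nat.exists_eq_add_of_le hlk
  obtain ⟨l, rfl⟩ := Nat.exists_eq_add_of_le' hl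
  by_cases hl1 : l = 0
  · subst hl1
    refine ⟨Ideal.span {pair (p ^ (e + 1)) (y + p ^ e * w)} ::ₘ 0, step hIat hJat
      (memcons hπ (memcons ⟨e + 1, _, by omega, ?_, rfl⟩ memnil)) ?_ (by simp) (by simp)⟩
    · rcases Nat.eq_zero_or_pos e with rfl | he
      · left; rfl
      · right
        rw [dvd_add_left ((dvd_pow_self p (by omega)).mul_right w)]
        exact hy.resolve_left (by omega)
    · simp only [Multiset.prod_cons, Multiset.prod_zero, mul_one,
        Ideal.span_singleton_mul_span_singleton, pair_mul]
      ring_nf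
  obtain ⟨j, rfl⟩ := Nat.exists_eq_add_of_le' (Nat.pos_of_ne_zero hl1)
  have hw' : ¬ p ∣ w := hw.resolve_left (by omega)
  have hy' : ¬ p ∣ y := hy.resolve_left (by omega)
  by_cases hdvd : p ∣ y + p ^ e * w
  swap
  · refine ⟨Ideal.span {pair (p ^ (j + 1 + 1 + e)) (y + p ^ e * w - p ^ (e + 1))} ::ₘ
      Ideal.span {pair (p ^ (j + 1)) 1} ::ₘ 0, step hIat hJat
      (memcons hπ (memcons (isAtomAt_span_pow (by omega) ?_)
        (memcons (isAtomAt_span_pow (by omega) hp1) memnil))) ?_ (by simp) (by simp)⟩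
    · rwa [dvd_sub_left (dvd_pow_self p (by omega))]
    · simp only [Multiset.prod_cons, Multiset.prod_zero, mul_one,
        Ideal.span_singleton_mul_span_singleton, pair_mul]
      ring_nf
  obtain rfl : e = 0 := by
    by_contra he
    exact hy' ((dvd_add_left ((dvd_pow_self p he).mul_right w)).mp hdvd)
  obtain ⟨c, hc⟩ := hdvd
  rw [pow_zero, one_mul] at hc
  obtain rfl : w = p * c - y := by linear_combination hc
  by_cases hj : j = 0
  · subst hj
    refine ⟨Ideal.span {pair p 0} ::ₘ Ideal.span {pair p 0} ::ₘ Ideal.span {pair p c} ::ₘ 0,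
      step hIat hJat (memcons hπ (memcons hπ (memcons hπ (memcons (isAtomAt_span p c) memnil))))
      ?_ (by simp) (by simp)⟩
    simp only [Multiset.prod_cons, Multiset.prod_zero, mul_one,
      Ideal.span_singleton_mul_span_singleton, pair_mul]
    ring_nf
  obtain ⟨i, rfl⟩ := Nat.exists_eq_add_of_le' (Nat.pos_of_ne_zero hj)
  by_cases hpc : p ∣ c
  · refine ⟨Ideal.span {pair p 0} ::ₘ Ideal.span {pair (p ^ (i + 2)) 1} ::ₘ
      Ideal.span {pair (p ^ (i + 2)) (c - 1)} ::ₘ 0, step hIat hJat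
      (memcons hπ (memcons hπ (memcons (isAtomAt_span_pow (by omega) hp1)
        (memcons (isAtomAt_span_pow (by omega) ?_) memnil)))) ?_ (by simp) (by simp)⟩
    · rwa [dvd_sub_right hpc]
    · simp only [Multiset.prod_cons, Multiset.prod_zero, mul_one,
        Ideal.span_singleton_mul_span_singleton, pair_mul]
      ring_nf
  by_cases hi : i = 0
  · subst hi
    have hpn1 : ¬ p ∣ -1 := by rwa [dvd_neg]
    have a1 : IsAtomAt p (Ideal.span {pair (p ^ 2) 1}) := isAtomAt_span_pow (by omega) hp1
    have a2 : IsAtomAt p (Ideal.span {pair (p ^ 2) (-1)}) := isAtomAt_span_pow (by omega) hpn1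
    have a3 : IsAtomAt p (Ideal.span {pair (p ^ 2) c}) := isAtomAt_span_pow (by omega) hpc
    refine ⟨Ideal.span {pair p 0} ::ₘ Ideal.span {pair p 0} ::ₘ Ideal.span {pair p 0} ::ₘ 0 +
      {Ideal.span {pair (p ^ 2) c}}, Relation.ReflTransGen.trans
      (b := {Ideal.span {pair (p ^ 2) 1}, Ideal.span {pair (p ^ 2) (-1)}} +
        {Ideal.span {pair (p ^ 2) c}})
      (step hIat hJat (memcons a1 (memcons a2 (memcons a3 memnil))) ?_ (by simp) (by simp)) ?_⟩
    · simp only [Multiset.insert_eq_cons, Multiset.prod_add, Multiset.prod_singleton,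
        Multiset.prod_cons, Ideal.span_singleton_mul_span_singleton, pair_mul]
      ring_nf
    · rw [← Multiset.cons_add]
      refine Linked.add_right (step a1 a2
        (memcons hπ (memcons hπ (memcons hπ (memcons hπ memnil)))) ?_ (by simp) (by simp)) ?_
      · simp only [Multiset.prod_cons, Multiset.prod_zero, mul_one,
          Ideal.span_singleton_mul_span_singleton, pair_mul]
        ring_nf
      · exact forall_mem_of_isAtomAt hp (memcons a3 memnil)
  · obtain ⟨m, rfl⟩ := Nat.exists_eq_add_of_le' (Nat.pos_of_ne_zero hi)
    refine ⟨Ideal.span {pair (p ^ (m + 3)) (c - p - p ^ (m + 1))} ::ₘ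
      Ideal.span {pair (p ^ (m + 2)) 1} ::ₘ Ideal.span {pair (p ^ 2) 1} ::ₘ 0, step hIat hJat
      (memcons hπ (memcons (isAtomAt_span_pow (by omega) ?_)
        (memcons (isAtomAt_span_pow (by omega) hp1)
          (memcons (isAtomAt_span_pow (by omega) hp1) memnil)))) ?_ (by simp) (by simp)⟩
    · rwa [dvd_sub_left (dvd_pow_self p (by omega)), dvd_sub_left dvd_rfl]
    · simp only [Multiset.prod_cons, Multiset.prod_zero, mul_one,
        Ideal.span_singleton_mul_span_singleton, pair_mul]
      ring_nf

end Pairs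

variable [IsPrincipalIdealRing D]

open Classical in
lemma exists_linked_cons {p : D} (hp : Prime p) {z : Multiset (Ideal (selfIdealization D))}
    (hz : ∀ I ∈ z, IsAtomIdeal I) (he : epsIdeal D ∉ z)
    (h2 : 2 ≤ Multiset.card (z.filter (· ≤ primeAbove p))) :
    ∃ w, Linked z (Ideal.span {pair p 0} ::ₘ w) := by
  have hat := forall_filter_isAtomAt hp hz he
  obtain ⟨I, hI⟩ := Multiset.card_pos_iff_exists_mem.mp (Nat.lt_of_lt_of_le Nat.zero_lt_two h2)
  obtain ⟨t, ht⟩ := Multiset.exists_cons_of_mem hI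
  rw [ht, Multiset.card_cons] at h2
  obtain ⟨J, hJ⟩ := Multiset.card_pos_iff_exists_mem.mp (show 0 < Multiset.card t by omega)
  obtain ⟨t', rfl⟩ := Multiset.exists_cons_of_mem hJ
  have hzeq : z = {I, J} + (t' + z.filter fun L => ¬ L ≤ primeAbove p) := by
    conv_lhs => rw [← Multiset.filter_add_not (· ≤ primeAbove p) z, ht]
    simp [Multiset.insert_eq_cons]
  rw [ht] at hat
  obtain ⟨w, hw⟩ := exists_linked_pair hp (hat I (by simp)) (hat J (by simp))
  refine ⟨w + (t' + z.filter fun L => ¬ L ≤ primeAbove p), ?_⟩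
  have := hw.add_right (c := t' + z.filter fun L => ¬ L ≤ primeAbove p) (fun L hL => hz L (by
    rw [hzeq]; exact Multiset.mem_add.mpr (Or.inr hL)))
  rwa [← hzeq, Multiset.cons_add] at this

open Classical in
/-- If a regular element has a factorization with only one factor over `p`, then this factor
occurs in all of its factorizations. -/
lemma mem_of_filter_eq_singleton {p : D} (hp : Prime p)
    {z z' : Multiset (Ideal (selfIdealization D))} {I : Ideal (selfIdealization D)} {a b : D}
    (ha : a ≠ 0) (hz : IsFactorization z (Ideal.span {pair a b}))
    (hz' : IsFactorization z' (Ideal.span {pair a b}))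
    (hI : z.filter (· ≤ primeAbove p) = {I}) : I ∈ z' := by
  obtain ⟨k, y, hk, hy, hIeq⟩ := forall_filter_isAtomAt hp hz.1 (epsIdeal_notMem ha hz.2) I
    (by rw [hI]; simp)
  have hat' := forall_filter_isAtomAt hp hz'.1 (epsIdeal_notMem ha hz'.2)
  obtain ⟨n, x, -, -, hx⟩ := prod_eq_of_forall_isAtomAt hat'
  obtain ⟨c, d, hc, hcd⟩ := prod_filter_not_eq hp hz.1
  obtain ⟨c', d', hc', hcd'⟩ := prod_filter_not_eq hp hz'.1
  have e1 : Ideal.span {pair (p ^ k) y * pair c d} = Ideal.span {pair a b} := by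
    rw [← hz.2, ← Multiset.filter_add_not (· ≤ primeAbove p) z, Multiset.prod_add, hI, hcd,
      Multiset.prod_singleton, hIeq, Ideal.span_singleton_mul_span_singleton]
  have e2 : Ideal.span {pair (p ^ n) x * pair c' d'} = Ideal.span {pair a b} := by
    rw [← hz'.2, ← Multiset.filter_add_not (· ≤ primeAbove p) z', Multiset.prod_add, hcd', hx,
      Ideal.span_singleton_mul_span_singleton]
  have hassoc := span_eq_iff.mp (e1.trans e2.symm)
  have d1 : pair (p ^ k) y ∣ pair (p ^ n) x :=
    pair_dvd_of_dvd_mul hp hc' ((dvd_mul_right _ _).trans hassoc.dvd)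
  have d2 : pair (p ^ n) x ∣ pair (p ^ k) y :=
    pair_dvd_of_dvd_mul hp hc ((dvd_mul_right _ _).trans hassoc.symm.dvd)
  have hprod : (z'.filter (· ≤ primeAbove p)).prod = I := by
    rw [hx, hIeq]
    exact le_antisymm (Ideal.span_singleton_le_span_singleton.mpr d1)
      (Ideal.span_singleton_le_span_singleton.mpr d2)
  rw [hIeq] at hprod ⊢
  have hsingle := eq_singleton_of_prod_eq (isAtomElt_pair_pow hp hk hy)
    (by simpa using pow_ne_zero k hp.ne_zero)
    (fun L hL => hz'.1 L (Multiset.mem_of_mem_filter hL)) hprod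
  exact Multiset.mem_of_mem_filter (p := (· ≤ primeAbove p)) (by simp [hsingle])

/-- Any two factorizations of a regular element are linked. By induction it suffices to link both
of them to factorizations that have a factor in common. -/
lemma linked_of_regular (a : D) : a ≠ 0 → ∀ (b : D) (z z' : Multiset (Ideal (selfIdealization D))),
    IsFactorization z (Ideal.span {pair a b}) → IsFactorization z' (Ideal.span {pair a b}) →
    Linked z z' := by
  classical
  induction a using (wellFounded_dvdNotUnit (α := D)).induction with
  | _ a ih =>
  intro ha b z z' hz hz'
  by_cases hau : IsUnit a
  · rw [Ideal.span_singleton_eq_top.mpr (isUnit_pair.mpr hau)] at hz hz'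
    rw [hz.eq_zero, hz'.eq_zero]
    exact Relation.ReflTransGen.refl
  -- the inductive step, for factorizations with the common factor `(q, y)`
  have cancel : ∀ (q y : D) (w w' : Multiset (Ideal (selfIdealization D))), ¬ IsUnit q →
      IsFactorization (Ideal.span {pair q y} ::ₘ w) (Ideal.span {pair a b}) →
      IsFactorization (Ideal.span {pair q y} ::ₘ w') (Ideal.span {pair a b}) →
      Linked (Ideal.span {pair q y} ::ₘ w) (Ideal.span {pair q y} ::ₘ w') := by
    intro q y w w' hq hw hw'
    have hwat : ∀ L ∈ w, IsAtomIdeal L := fun L hL => hw.1 L (Multiset.mem_cons_of_mem hL)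
    have hwat' : ∀ L ∈ w', IsAtomIdeal L := fun L hL => hw'.1 L (Multiset.mem_cons_of_mem hL)
    obtain ⟨r, hr⟩ := exists_span_of_forall_isAtomIdeal hwat
    obtain ⟨c, d, rfl⟩ := exists_eq_pair r
    have h1 := hw.2
    rw [Multiset.prod_cons, hr, Ideal.span_singleton_mul_span_singleton, pair_mul,
      span_eq_iff] at h1
    have h2 := h1.map (fst : selfIdealization D →+* D)
    rw [fst_pair, fst_pair] at h2
    have hqc : q * c ≠ 0 := fun h => ha (by rwa [h, Associated.comm, associated_zero_iff_eq_zero]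
      at h2)
    have hprod : w'.prod = w.prod := by
      refine span_mul_cancel (r := pair q y) (by simpa using left_ne_zero_of_mul hqc) ?_
      rw [← Multiset.prod_cons, ← Multiset.prod_cons, hw.2, hw'.2]
    obtain ⟨e, he⟩ := h2
    have hlt : DvdNotUnit c a := ⟨right_ne_zero_of_mul hqc, q * e,
      fun h => hq (isUnit_of_mul_isUnit_left h), by rw [← he]; ring⟩
    have hl := ih c hlt (right_ne_zero_of_mul hqc) d w w' ⟨hwat, hr⟩ ⟨hwat', hprod.trans hr⟩
    have := hl.add_right (c := {Ideal.span {pair q y}}) (fun L hL => by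
      rw [Multiset.mem_singleton] at hL
      exact hw.1 L (hL ▸ Multiset.mem_cons_self _ _))
    simpa only [add_comm _ {Ideal.span {pair q y}}, Multiset.singleton_add] using this
  obtain ⟨p, hpi, hpa⟩ := WfDvdMonoid.exists_irreducible_factor hau ha
  have hp := hpi.prime
  -- if some factorization has just one factor over `p`, this is the common factor
  have single : ∀ z z', IsFactorization z (Ideal.span {pair a b}) →
      IsFactorization z' (Ideal.span {pair a b}) →
      Multiset.card (z.filter (· ≤ primeAbove p)) = 1 → Linked z z' := by
    intro z z' hz hz' h1
    obtain ⟨I, hI⟩ := Multiset.card_eq_one.mp h1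
    have hIz : I ∈ z := Multiset.mem_of_mem_filter (p := (· ≤ primeAbove p)) (by simp [hI])
    obtain ⟨k, y, hk, hy, rfl⟩ := forall_filter_isAtomAt hp hz.1 (epsIdeal_notMem ha hz.2) I
      (by rw [hI]; simp)
    have hIz' := mem_of_filter_eq_singleton hp ha hz hz' hI
    obtain ⟨w, rfl⟩ := Multiset.exists_cons_of_mem hIz
    obtain ⟨w', rfl⟩ := Multiset.exists_cons_of_mem hIz'
    exact cancel _ _ w w' (fun h => hp.not_isUnit ((isUnit_pow_iff (by omega)).mp h)) hz hz'
  have pos : ∀ z, IsFactorization z (Ideal.span {pair a b}) →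
      1 ≤ Multiset.card (z.filter (· ≤ primeAbove p)) := by
    intro z hz
    have := span_le_primeAbove (b := b).mpr hpa
    rw [← hz.2, (primeAbove_isPrime hp).multiset_prod_le] at this
    obtain ⟨I, hI, hle⟩ := this
    exact Multiset.card_pos_iff_exists_mem.mpr ⟨I, Multiset.mem_filter.mpr ⟨hI, hle⟩⟩
  rcases (pos z hz).eq_or_lt with h1 | h1
  · exact single z z' hz hz' h1.symm
  rcases (pos z' hz').eq_or_lt with h1' | h1'
  · exact (single z' z hz' hz h1'.symm).symm
  obtain ⟨w, hw⟩ := exists_linked_cons hp hz.1 (epsIdeal_notMem ha hz.2) h1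
  obtain ⟨w', hw'⟩ := exists_linked_cons hp hz'.1 (epsIdeal_notMem ha hz'.2) h1'
  exact (Relation.ReflTransGen.trans hw (cancel p 0 w w' hp.not_isUnit (hw.isFactorization hz)
    (hw'.isFactorization hz'))).trans hw'.symm

/-- A nonregular element has exactly one nilpotent factor in each of its factorizations. -/
lemma IsFactorization.exists_eq_cons {z : Multiset (Ideal (selfIdealization D))} {b : D}
    (hb : b ≠ 0) (hz : IsFactorization z (Ideal.span {pair 0 b})) :
    ∃ w, z = epsIdeal D ::ₘ w ∧ epsIdeal D ∉ w := by
  have he : epsIdeal D ∈ z := by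
    by_contra he
    obtain ⟨c, d, hc, hcd⟩ := prod_eq_span_of_regular hz.1 he
    exact fst_ne_zero_of_span_eq (hcd.symm.trans hz.2) (by simpa using hc) (by simp)
  obtain ⟨w, rfl⟩ := Multiset.exists_cons_of_mem he
  refine ⟨w, rfl, fun hew => hb ?_⟩
  obtain ⟨v, rfl⟩ := Multiset.exists_cons_of_mem hew
  have h := hz.2
  rw [Multiset.prod_cons, Multiset.prod_cons, ← mul_assoc] at h
  nth_rw 2 [epsIdeal] at h
  rw [epsIdeal_mul_span, pair_zero, Ideal.span_singleton_zero, Ideal.bot_mul, eq_comm,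
    Ideal.span_singleton_eq_bot, ← pair_zero, pair_inj] at h
  exact h.2

omit [IsPrincipalIdealRing D] in
/-- In the presence of `ε`, a factor `(p ^ k, y)` may be replaced by `k` factors `(p, 0)`. -/
lemma linked_eps_replicate {p : D} (hp : Prime p) (k : ℕ) : ∀ y : D, 1 ≤ k → (k = 1 ∨ ¬ p ∣ y) →
    Linked {epsIdeal D, Ideal.span {pair (p ^ k) y}}
      ({epsIdeal D} + Multiset.replicate k (Ideal.span {pair p 0})) := by
  have hat : ∀ I ∈ ({Ideal.span {pair p 0}} : Multiset (Ideal (selfIdealization D))),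
      IsAtomIdeal I := by
    simpa using (isAtomAt_span p 0).isAtomIdeal hp
  induction k with
  | zero => intro y h; omega
  | succ k ih =>
    intro y _ hy
    have hI : IsAtomIdeal (Ideal.span {pair (p ^ (k + 1)) y}) := ⟨_,
      isAtomElt_pair_pow hp (by omega) hy, rfl⟩
    rcases Nat.eq_zero_or_pos k with rfl | hk
    · refine .single (step_of_card_le ?_ ?_ ?_ (by simp) (by simp) (by simp) (by simp))
      · simpa [Multiset.insert_eq_cons, isAtomIdeal_epsIdeal] using hI
      · simpa [isAtomIdeal_epsIdeal] using hat
      · simp [epsIdeal_mul_span]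
    · have hp1 : ¬ p ∣ 1 := fun h => hp.not_isUnit (isUnit_of_dvd_one h)
      have hJ : IsAtomIdeal (Ideal.span {pair (p ^ k) 1}) := ⟨_,
        isAtomElt_pair_pow hp hk (Or.inr hp1), rfl⟩
      have h1 := (ih 1 hk (Or.inr hp1)).add_right hat
      rw [Multiset.replicate_succ, ← Multiset.singleton_add, add_comm {Ideal.span {pair p 0}},
        ← add_assoc]
      refine Relation.ReflTransGen.head (step_of_card_le ?_ ?_ ?_ (by simp) (by simp) (by simp)
        (by simp)) h1
      · simpa [Multiset.insert_eq_cons] using ⟨isAtomIdeal_epsIdeal, hI⟩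
      · simpa [Multiset.insert_eq_cons, isAtomIdeal_epsIdeal, hJ] using hat
      · simp [epsIdeal_mul_span, pow_succ, Ideal.span_singleton_mul_span_singleton, pair_mul]

/-- In the presence of `ε`, every factorization of a regular element with diagonal entry `a` is
linked to the one that corresponds to a prime factorization of `a` in `D`. -/
lemma exists_linked_eps_primes {w : Multiset (Ideal (selfIdealization D))}
    (hw : ∀ I ∈ w, IsAtomIdeal I) (he : epsIdeal D ∉ w) :
    ∃ (a b : D) (s : Multiset D), w.prod = Ideal.span {pair a b} ∧ (∀ q ∈ s, Prime q) ∧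
      s.prod = a ∧ Linked (epsIdeal D ::ₘ w)
        (epsIdeal D ::ₘ s.map fun q => Ideal.span {pair q 0}) := by
  induction w using Multiset.induction with
  | empty =>
    exact ⟨1, 0, 0, by simp [pair_one], by simp, by simp, Relation.ReflTransGen.refl⟩
  | cons I w ih =>
    have hw' : ∀ L ∈ w, IsAtomIdeal L := fun L hL => hw L (Multiset.mem_cons_of_mem hL)
    obtain ⟨a, b, s, hab, hs, hsa, hl⟩ := ih hw' (fun h => he (Multiset.mem_cons_of_mem h))
    obtain ⟨p, hp, k, y, hk, hy, rfl⟩ := (hw I (Multiset.mem_cons_self I w)).classify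
      (fun h => he (h ▸ Multiset.mem_cons_self I w))
    refine ⟨p ^ k * a, p ^ k * b + y * a, s + Multiset.replicate k p, ?_, ?_, ?_, ?_⟩
    · rw [Multiset.prod_cons, hab, Ideal.span_singleton_mul_span_singleton, pair_mul]
    · intro q hq
      rcases Multiset.mem_add.mp hq with h | h
      · exact hs q h
      · rwa [Multiset.eq_of_mem_replicate h]
    · rw [Multiset.prod_add, hsa, Multiset.prod_replicate, mul_comm]
    · have h1 := (linked_eps_replicate hp k y hk hy).add_right hw'
      have h2 := hl.add_right (c := Multiset.replicate k (Ideal.span {pair p 0})) (fun L hL => by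
        rw [Multiset.eq_of_mem_replicate hL]
        exact (isAtomAt_span p 0).isAtomIdeal hp)
      rw [Multiset.map_add, Multiset.map_replicate, ← Multiset.cons_add]
      refine Relation.ReflTransGen.trans ?_ h2
      rwa [add_right_comm, Multiset.insert_eq_cons, Multiset.cons_add, Multiset.singleton_add,
        Multiset.singleton_add] at h1

/-- Any two factorizations of a nonzero nonunit of `R(D)` are linked. -/
theorem linked_of_mem_factorizations {a : selfIdealization D} (h0 : a ≠ 0) (ha : ¬ IsUnit a)
    {z z' : Multiset (Ideal (selfIdealization D))} (hz : z ∈ factorizations a)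
    (hz' : z' ∈ factorizations a) : Linked z z' := by
  rw [mem_factorizations_iff ha] at hz hz'
  obtain ⟨a, b, rfl⟩ := exists_eq_pair a
  by_cases ha0 : a = 0
  swap
  · exact linked_of_regular a ha0 b z z' hz hz'
  subst ha0
  have hb : b ≠ 0 := by rintro rfl; exact h0 pair_zero
  have key : ∀ z, IsFactorization z (Ideal.span {pair 0 b}) → ∃ s : Multiset D,
      (∀ q ∈ s, Prime q) ∧ Associated s.prod b ∧
        Linked z (epsIdeal D ::ₘ s.map fun q => Ideal.span {pair q 0}) := by
    intro z hz
    obtain ⟨w, rfl, hew⟩ := hz.exists_eq_cons hb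
    obtain ⟨c, d, s, hcd, hs, rfl, hl⟩ := exists_linked_eps_primes
      (fun L hL => hz.1 L (Multiset.mem_cons_of_mem hL)) hew
    refine ⟨s, hs, ?_, hl⟩
    have h := hz.2
    rw [Multiset.prod_cons, hcd, epsIdeal_mul_span, span_eq_iff] at h
    obtain ⟨u, hu⟩ := h
    obtain ⟨e, f, hef⟩ := exists_eq_pair (u : selfIdealization D)
    have he : IsUnit e := isUnit_pair.mp (hef ▸ u.isUnit)
    rw [hef, pair_mul, pair_inj] at hu
    exact ⟨he.unit, by simpa using hu.2⟩
  obtain ⟨s, hs, hsb, hl⟩ := key z hz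
  obtain ⟨s', hs', hsb', hl'⟩ := key z' hz'
  have hrel := prime_factors_unique hs hs' (hsb.trans hsb'.symm)
  have hmap : (s.map fun q => Ideal.span {pair q 0}) = s'.map fun q => Ideal.span {pair q 0} := by
    rw [← Multiset.rel_eq, Multiset.rel_map]
    refine hrel.mono fun q _ q' _ hqq => span_eq_iff.mpr ?_
    obtain ⟨u, rfl⟩ := hqq
    have hu : IsUnit (pair (u : D) 0) := isUnit_pair.mpr u.isUnit
    exact ⟨hu.unit, by rw [IsUnit.unit_spec, pair_mul]; simp⟩
  rw [hmap] at hl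
  exact Relation.ReflTransGen.trans hl hl'.symm

end Linking

section Tameness

variable {D : Type*} [CommRing D] [IsDomain D]

/-! ### Short factorizations and local tameness -/

section Short

/-- `r` is a product of at most `N` irreducible elements over `p`, up to a unit. -/
def HasShortFactorization (p : D) (r : selfIdealization D) (N : ℕ) : Prop :=
  ∃ z : Multiset (Ideal (selfIdealization D)), (∀ I ∈ z, IsAtomAt p I) ∧ Multiset.card z ≤ N ∧
    z.prod = Ideal.span {r}

variable {p : D}

omit [IsDomain D] in
lemma HasShortFactorization.mul {r s : selfIdealization D} {N M : ℕ}
    (hr : HasShortFactorization p r N) (hs : HasShortFactorization p s M) :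
    HasShortFactorization p (r * s) (N + M) := by
  obtain ⟨z, hz, hzN, hzr⟩ := hr
  obtain ⟨w, hw, hwM, hws⟩ := hs
  refine ⟨z + w, fun I hI => (Multiset.mem_add.mp hI).elim (hz I) (hw I), ?_, ?_⟩
  · rw [Multiset.card_add]; omega
  · rw [Multiset.prod_add, hzr, hws, Ideal.span_singleton_mul_span_singleton]

omit [IsDomain D] in
lemma HasShortFactorization.mono {r : selfIdealization D} {N M : ℕ}
    (hr : HasShortFactorization p r N) (h : N ≤ M) : HasShortFactorization p r M := by
  obtain ⟨z, hz, hzN, hzr⟩ := hr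
  exact ⟨z, hz, hzN.trans h, hzr⟩

omit [IsDomain D] in
lemma hasShortFactorization_of_not_dvd {y : D} (k : ℕ) (hy : ¬ p ∣ y) :
    HasShortFactorization p (pair (p ^ k) y) 1 := by
  rcases Nat.eq_zero_or_pos k with rfl | hk
  · refine ⟨0, by simp, by simp, ?_⟩
    rw [Multiset.prod_zero, Ideal.one_eq_top, eq_comm, Ideal.span_singleton_eq_top, isUnit_pair]
    simp
  · exact ⟨{Ideal.span {pair (p ^ k) y}}, by simpa using isAtomAt_span_pow hk hy, by simp,
      by simp⟩

omit [IsDomain D] in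
lemma hasShortFactorization_scalar (i : ℕ) : HasShortFactorization p (pair (p ^ i) 0) i := by
  refine ⟨Multiset.replicate i (Ideal.span {pair p 0}), fun I hI => ?_, by simp, ?_⟩
  · rw [Multiset.eq_of_mem_replicate hI]; exact isAtomAt_span p 0
  · rw [Multiset.prod_replicate, Ideal.span_singleton_pow, pair_pow_zero]

variable [IsPrincipalIdealRing D]

/-- Elements with a power of `p` on the diagonal have factorizations of bounded length. -/
lemma hasShortFactorization (hp : Prime p) (n : ℕ) (b : D) :
    HasShortFactorization p (pair (p ^ n) b) 4 := by
  have hp1 : ¬ p ∣ 1 := fun h => hp.not_isUnit (isUnit_of_dvd_one h)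
  rcases Nat.lt_or_ge n 2 with hn | hn
  · rcases Nat.eq_zero_or_pos n with rfl | hn0
    · refine ⟨0, by simp, by simp, ?_⟩
      rw [Multiset.prod_zero, Ideal.one_eq_top, eq_comm, Ideal.span_singleton_eq_top, isUnit_pair]
      simp
    · obtain rfl : n = 1 := by omega
      rw [pow_one]
      exact ⟨{Ideal.span {pair p b}}, by simpa using isAtomAt_span p b, by simp, by simp⟩
  obtain ⟨k, r, hr, rfl⟩ : ∃ k r, r < 2 ∧ n = k + k + r := ⟨n / 2, n % 2, by omega, by omega⟩
  by_cases hdvd : p ^ (k + r + 1) ∣ b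
  · obtain ⟨c, rfl⟩ := hdvd
    have h1 : ¬ p ∣ p * c - 1 := by rwa [dvd_sub_right (dvd_mul_right p c)]
    have := ((hasShortFactorization_of_not_dvd k hp1).mul
      (hasShortFactorization_of_not_dvd k h1)).mul (hasShortFactorization_scalar (p := p) r)
    refine HasShortFactorization.mono (N := 1 + 1 + r) ?_ (by omega)
    convert! this using 1
    rw [pair_mul, pair_mul, pair_inj]
    constructor <;> ring
  · have hb : b ≠ 0 := by rintro rfl; exact hdvd (dvd_zero _)
    obtain ⟨j, c, hpc, rfl⟩ := WfDvdMonoid.max_power_factor hb hp.irreducible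
    have hj : j ≤ k + r := by
      by_contra hj
      exact hdvd ((pow_dvd_pow p (by omega)).mul_right c)
    -- the main factor has exponent `m = j' + e + 1` on the diagonal, where `m + j' + i = n`
    obtain ⟨j', i, e, hi, rfl, hm⟩ : ∃ j' i e, i ≤ 2 ∧ j = j' + i ∧
        k + k + r = j' + e + 1 + j' + i := by
      rcases Nat.lt_or_ge j (k + k + r - j) with h | h
      · exact ⟨j, 0, k + k + r - j - j - 1, by omega, by omega, by omega⟩
      · exact ⟨k + k + r - j - 1, j + j + 1 - (k + k + r), 0, by omega, by omega, by omega⟩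
    have h1 : ¬ p ∣ c - p ^ (e + 1) := by rwa [dvd_sub_left (dvd_pow_self p (by omega))]
    have := ((hasShortFactorization_of_not_dvd (j' + e + 1) h1).mul
      (hasShortFactorization_of_not_dvd j' hp1)).mul (hasShortFactorization_scalar (p := p) i)
    refine HasShortFactorization.mono (N := 1 + 1 + i) ?_ (by omega)
    convert! this using 1
    rw [pair_mul, pair_mul, pair_inj, hm]
    constructor <;> ring

end Short

lemma exists_le_card_eq {α : Type*} {s : Multiset α} {n : ℕ} (h : n ≤ Multiset.card s) :
    ∃ t ≤ s, Multiset.card t = n := by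
  have hpos : 0 < Multiset.card (Multiset.powersetCard n s) := by
    rw [Multiset.card_powersetCard]; exact Nat.choose_pos h
  obtain ⟨t, ht⟩ := Multiset.card_pos_iff_exists_mem.mp hpos
  exact ⟨t, Multiset.mem_powersetCard.mp ht⟩

variable [IsPrincipalIdealRing D]

open Classical in
/-- If `(p ^ k, y)` divides a regular element, then it already divides the product of at most
`2 * k + 1` factors of any given factorization. -/
lemma exists_le_prod_le {p y : D} {k : ℕ} (hp : Prime p)
    {z : Multiset (Ideal (selfIdealization D))} (hz : ∀ I ∈ z, IsAtomIdeal I)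
    (he : epsIdeal D ∉ z) (hle : z.prod ≤ Ideal.span {pair (p ^ k) y}) :
    ∃ z₀ ≤ z, (∀ I ∈ z₀, IsAtomAt p I) ∧ Multiset.card z₀ ≤ 2 * k + 1 ∧
      z₀.prod ≤ Ideal.span {pair (p ^ k) y} := by
  have hat := forall_filter_isAtomAt hp hz he
  rcases Nat.lt_or_ge (Multiset.card (z.filter (· ≤ primeAbove p))) (2 * k + 1) with h | h
  · refine ⟨_, Multiset.filter_le _ z, hat, h.le, ?_⟩
    obtain ⟨n, b, -, -, hb⟩ := prod_eq_of_forall_isAtomAt hat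
    obtain ⟨c, d, hc, hcd⟩ := prod_filter_not_eq hp hz
    rw [← Multiset.filter_add_not (· ≤ primeAbove p) z, Multiset.prod_add, hcd, hb,
      Ideal.span_singleton_mul_span_singleton, Ideal.span_singleton_le_span_singleton] at hle
    rw [hb, Ideal.span_singleton_le_span_singleton]
    exact pair_dvd_of_dvd_mul hp hc hle
  · obtain ⟨z₀, hz₀, hcard⟩ := exists_le_card_eq h
    have hat₀ : ∀ I ∈ z₀, IsAtomAt p I := fun I hI => hat I (Multiset.mem_of_le hz₀ hI)
    refine ⟨z₀, hz₀.trans (Multiset.filter_le _ z), hat₀, hcard.le, ?_⟩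
    -- the product is divisible by `(p ^ (2 * k), 0) = (p ^ k, y) (p ^ k, -y)`
    obtain ⟨n, b, hn, ⟨c, hc⟩, hb⟩ := prod_eq_of_forall_isAtomAt hat₀
    rw [hb, Ideal.span_singleton_le_span_singleton]
    rw [hcard] at hn hc
    obtain ⟨m, rfl⟩ := Nat.exists_eq_add_of_le hn
    refine ⟨pair (p ^ k) (-y) * pair (p ^ (m + 1)) c, ?_⟩
    rw [← mul_assoc, pair_mul, pair_mul, pair_inj, hc]
    constructor
    · ring
    · rw [Nat.add_sub_cancel]; ring

open Classical in
/-- The analogue of `exists_le_prod_le` in the presence of the factor `ε`, where only the diagonal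
entries matter. -/
lemma exists_le_pow_dvd {p a b : D} {k : ℕ} (hp : Prime p)
    {z : Multiset (Ideal (selfIdealization D))} (hz : ∀ I ∈ z, IsAtomIdeal I)
    (he : epsIdeal D ∉ z) (hab : z.prod = Ideal.span {pair a b}) (hdvd : p ^ k ∣ a) :
    ∃ z₀ ≤ z, (∀ I ∈ z₀, IsAtomAt p I) ∧ Multiset.card z₀ ≤ k ∧
      ∃ n x, k ≤ n ∧ z₀.prod = Ideal.span {pair (p ^ n) x} := by
  have hat := forall_filter_isAtomAt hp hz he
  rcases Nat.lt_or_ge (Multiset.card (z.filter (· ≤ primeAbove p))) k with h | h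
  · refine ⟨_, Multiset.filter_le _ z, hat, h.le, ?_⟩
    obtain ⟨n, x, -, -, hx⟩ := prod_eq_of_forall_isAtomAt hat
    obtain ⟨c, d, hc, hcd⟩ := prod_filter_not_eq hp hz
    refine ⟨n, x, ?_, hx⟩
    rw [← Multiset.filter_add_not (· ≤ primeAbove p) z, Multiset.prod_add, hcd, hx,
      Ideal.span_singleton_mul_span_singleton, pair_mul, span_eq_iff] at hab
    have h1 := hab.map (fst : selfIdealization D →+* D)
    rw [fst_pair, fst_pair] at h1
    have h2 : p ^ k ∣ p ^ n :=
      hp.pow_dvd_of_dvd_mul_right k hc (hdvd.trans h1.symm.dvd)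
    exact (pow_dvd_pow_iff hp.ne_zero hp.not_isUnit).mp h2
  · obtain ⟨z₀, hz₀, hcard⟩ := exists_le_card_eq h
    have hat₀ : ∀ I ∈ z₀, IsAtomAt p I := fun I hI => hat I (Multiset.mem_of_le hz₀ hI)
    obtain ⟨n, x, hn, -, hx⟩ := prod_eq_of_forall_isAtomAt hat₀
    exact ⟨z₀, hz₀.trans (Multiset.filter_le _ z), hat₀, hcard.le, n, x, hcard ▸ hn, hx⟩

/-- The local tameness of a factorization with respect to the irreducible element `(p ^ k, y)`. -/
lemma exists_factorization_mem {p y : D} {k : ℕ} (hp : Prime p) (hk : 1 ≤ k)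
    (hy : k = 1 ∨ ¬ p ∣ y) {a : selfIdealization D} (h0 : a ≠ 0)
    {w z : Multiset (Ideal (selfIdealization D))} (hw : IsFactorization w (Ideal.span {a}))
    (hmem : Ideal.span {pair (p ^ k) y} ∈ w) (hz : IsFactorization z (Ideal.span {a})) :
    ∃ z', IsFactorization z' (Ideal.span {a}) ∧ Ideal.span {pair (p ^ k) y} ∈ z' ∧
      factDist z z' ≤ 2 * k + 5 := by
  have hu : IsAtomIdeal (Ideal.span {pair (p ^ k) y}) := ⟨_, isAtomElt_pair_pow hp hk hy, rfl⟩
  have hle : Ideal.span {a} ≤ Ideal.span {pair (p ^ k) y} := hw.2 ▸ multiset_prod_le_of_mem hmem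
  -- a bounded part `z₀` of `z` is replaced by `(p ^ k, y)` and a short factorization of `(p ^ m, x)`
  have replace : ∀ (z₀ r : Multiset (Ideal (selfIdealization D))) (m : ℕ) (x : D), z = z₀ + r →
      Multiset.card z₀ ≤ 2 * k + 1 →
      z₀.prod * r.prod = Ideal.span {pair (p ^ k) y} * Ideal.span {pair (p ^ m) x} * r.prod →
      ∃ z', IsFactorization z' (Ideal.span {a}) ∧ Ideal.span {pair (p ^ k) y} ∈ z' ∧
        factDist z z' ≤ 2 * k + 5 := by
    rintro z₀ r m x rfl hcard hprod
    obtain ⟨t, ht, htcard, htprod⟩ := hasShortFactorization hp m x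
    refine ⟨Ideal.span {pair (p ^ k) y} ::ₘ t + r, ⟨?_, ?_⟩, by simp, ?_⟩
    · intro I hI
      rcases Multiset.mem_add.mp hI with hI | hI
      · rcases Multiset.mem_cons.mp hI with rfl | hI
        exacts [hu, (ht I hI).isAtomIdeal hp]
      · exact hz.1 I (Multiset.mem_add.mpr (Or.inr hI))
    · rw [Multiset.prod_add, Multiset.prod_cons, htprod, ← hprod, ← Multiset.prod_add, hz.2]
    · rw [factDist_add_right]
      refine (factDist_le_max_card _ _).trans (max_le (by omega) ?_)
      rw [Multiset.card_cons]; omega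
  obtain ⟨a, b, rfl⟩ := exists_eq_pair a
  by_cases ha : a = 0
  · subst ha
    have hb : b ≠ 0 := by rintro rfl; exact h0 pair_zero
    obtain ⟨z, rfl, hez⟩ := hz.exists_eq_cons hb
    have hzat : ∀ I ∈ z, IsAtomIdeal I := fun I hI => hz.1 I (Multiset.mem_cons_of_mem hI)
    obtain ⟨c, d, -, hcd⟩ := prod_eq_span_of_regular hzat hez
    have hdvd : p ^ k ∣ c := by
      have h1 := hz.2
      rw [Multiset.prod_cons, hcd, epsIdeal_mul_span] at h1
      rw [← h1, Ideal.span_singleton_le_span_singleton] at hle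
      obtain ⟨s, hs⟩ := hle
      obtain ⟨e, f, rfl⟩ := exists_eq_pair s
      rw [pair_mul, pair_inj] at hs
      have he : e = 0 := (mul_eq_zero.mp hs.1.symm).resolve_left (pow_ne_zero k hp.ne_zero)
      exact ⟨f, by rw [hs.2, he]; ring⟩
    obtain ⟨z₀, hz₀, -, hcard, n, x, hkn, hx⟩ := exists_le_pow_dvd hp hzat hez hcd hdvd
    obtain ⟨r, rfl⟩ := Multiset.le_iff_exists_add.mp hz₀
    obtain ⟨m, rfl⟩ := Nat.exists_eq_add_of_le hkn
    refine replace z₀ (epsIdeal D ::ₘ r) m 0 (by rw [Multiset.add_cons]) (by omega) ?_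
    rw [Multiset.prod_cons, hx, ← mul_assoc, ← mul_assoc, Ideal.span_singleton_mul_span_singleton,
      mul_comm _ (epsIdeal D), mul_comm _ (epsIdeal D), pair_mul, epsIdeal_mul_span,
      epsIdeal_mul_span, pow_add]
  · have hez := epsIdeal_notMem ha hz.2
    obtain ⟨z₀, hz₀, hat₀, hcard, hle₀⟩ := exists_le_prod_le hp hz.1 hez (hz.2.le.trans hle)
    obtain ⟨r, rfl⟩ := Multiset.le_iff_exists_add.mp hz₀
    obtain ⟨n, x, -, -, hx⟩ := prod_eq_of_forall_isAtomAt hat₀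
    rw [hx, Ideal.span_singleton_le_span_singleton] at hle₀
    obtain ⟨s, hs⟩ := hle₀
    obtain ⟨c, d, rfl⟩ := exists_eq_pair s
    have h1 := hs
    rw [pair_mul, pair_inj] at h1
    have hkn : k ≤ n := (pow_dvd_pow_iff hp.ne_zero hp.not_isUnit).mp ⟨c, h1.1⟩
    obtain ⟨m, rfl⟩ := Nat.exists_eq_add_of_le hkn
    obtain rfl : p ^ m = c := by
      rw [pow_add] at h1
      exact mul_left_cancel₀ (pow_ne_zero k hp.ne_zero) h1.1
    refine replace z₀ r m d rfl hcard ?_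
    rw [hx, hs, Ideal.span_singleton_mul_span_singleton]

theorem isLocallyTame : IsLocallyTame (selfIdealization D) := by
  refine ⟨isAtomicRing, fun u hu => ?_⟩
  rcases hu.classify with h | ⟨p, k, y, hp, hk, hy, h⟩
  · -- the factor `ε` occurs either in all factorizations of an element or in none of them
    refine lt_of_le_of_lt (b := 0) (iSup_le ?_) (by simp)
    rintro ⟨a, h0, ha⟩
    refine sInf_le ?_
    rintro ⟨w, hw, hle⟩ z hz
    refine ⟨z, hz, ?_, by simp [factDist]⟩
    rw [Multiset.singleton_le, span_eq_iff.mpr h] at hle ⊢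
    rw [mem_factorizations_iff ha] at hw hz
    obtain ⟨a, b, rfl⟩ := exists_eq_pair a
    by_cases ha0 : a = 0
    · subst ha0
      have hb : b ≠ 0 := by rintro rfl; exact h0 pair_zero
      obtain ⟨v, rfl, -⟩ := hz.exists_eq_cons hb
      exact Multiset.mem_cons_self _ _
    · exact absurd hle (epsIdeal_notMem ha0 hw.2)
  · refine lt_of_le_of_lt (b := ((2 * k + 5 : ℕ) : ℕ∞)) (iSup_le ?_) (ENat.natCast_lt_top _)
    rintro ⟨a, h0, ha⟩
    refine sInf_le ?_
    rintro ⟨w, hw, hle⟩ z hz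
    rw [Multiset.singleton_le, span_eq_iff.mpr h] at hle
    rw [mem_factorizations_iff ha] at hw hz
    obtain ⟨z', hz', hmem, hd⟩ := exists_factorization_mem hp hk hy h0 hw hle hz
    refine ⟨z', (mem_factorizations_iff ha).mpr hz', ?_, by exact_mod_cast hd⟩
    rwa [Multiset.singleton_le, span_eq_iff.mpr h]

end Tameness

section Degree

variable {D : Type*} [CommRing D] [IsDomain D]

/-! ### Catenary degree and sets of distances -/

lemma mem_lengthSet_iff {R : Type*} [CommRing R] {a : R} {k : ℕ} :
    k ∈ lengthSet a ↔ ∃ z ∈ factorizations a, Multiset.card z = k := by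
  constructor
  · rintro ⟨s, hs, hp, hk⟩
    exact ⟨_, ⟨s, hs, hp, rfl⟩, by rw [Multiset.card_map, hk]⟩
  · rintro ⟨_, ⟨s, hs, hp, rfl⟩, hk⟩
    exact ⟨s, hs, hp, by rw [← hk, Multiset.card_map]⟩

section FourthPower

variable {p : D}

omit [IsDomain D] in
lemma not_isUnit_pair_pow (hp : Prime p) {n : ℕ} (hn : n ≠ 0) (b : D) :
    ¬ IsUnit (pair (p ^ n) b) := by
  rw [isUnit_pair, isUnit_pow_iff hn]
  exact hp.not_isUnit

lemma two_mem_lengthSet_pow_four (hp : Prime p) : 2 ∈ lengthSet (pair (p ^ 4) 0) := by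
  have hp1 : ¬ p ∣ 1 := fun h => hp.not_isUnit (isUnit_of_dvd_one h)
  refine ⟨pair (p ^ 2) 1 ::ₘ pair (p ^ 2) (-1) ::ₘ 0, ?_, ?_, rfl⟩
  · refine Multiset.forall_mem_cons.mpr ⟨isAtomElt_pair_pow hp (by omega) (Or.inr hp1),
      Multiset.forall_mem_cons.mpr ⟨isAtomElt_pair_pow hp (by omega) (Or.inr ?_),
        fun u hu => absurd hu (Multiset.notMem_zero u)⟩⟩
    rwa [dvd_neg]
  · rw [Multiset.prod_cons, Multiset.prod_cons, Multiset.prod_zero, mul_one, pair_mul, pair_inj]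
    constructor <;> ring

lemma four_mem_lengthSet_pow_four (hp : Prime p) : 4 ∈ lengthSet (pair (p ^ 4) 0) := by
  refine ⟨Multiset.replicate 4 (pair p 0), fun u hu => ?_, ?_, by simp⟩
  · rw [Multiset.eq_of_mem_replicate hu]
    simpa using isAtomElt_pair_pow (y := 0) hp le_rfl (Or.inl rfl)
  · rw [Multiset.prod_replicate, pair_pow_zero]

/-- Two factorizations of a regular element, one of length `2` and the other of larger length, have
no common factor. -/
lemma card_le_factDist {a b : D} (ha : a ≠ 0) {x y : Multiset (Ideal (selfIdealization D))}
    (hx : IsFactorization x (Ideal.span {pair a b}))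
    (hy : IsFactorization y (Ideal.span {pair a b})) (h2 : Multiset.card x = 2)
    (h3 : 3 ≤ Multiset.card y) : Multiset.card y ≤ factDist x y := by
  classical
  have hdisj : Disjoint x y := by
    rw [Multiset.disjoint_left]
    intro I hIx hIy
    obtain ⟨t, rfl⟩ := Multiset.exists_cons_of_mem hIx
    obtain ⟨t', rfl⟩ := Multiset.exists_cons_of_mem hIy
    rw [Multiset.card_cons] at h2 h3
    obtain ⟨J, rfl⟩ := Multiset.card_eq_one.mp (show Multiset.card t = 1 by omega)
    obtain ⟨u, hu, rfl⟩ := hx.1 I (Multiset.mem_cons_self _ _)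
    obtain ⟨v, hv, rfl⟩ := hx.1 J (by simp)
    have hprod := hx.2
    rw [Multiset.prod_cons, Multiset.prod_singleton, Ideal.span_singleton_mul_span_singleton]
      at hprod
    have h0 : fst (u * v) ≠ 0 := fst_ne_zero_of_span_eq hprod.symm (by simpa using ha)
    rw [map_mul] at h0
    have ht' := span_mul_cancel (left_ne_zero_of_mul h0) (A := t'.prod) (B := Ideal.span {v}) (by
      rw [Ideal.span_singleton_mul_span_singleton, hprod, ← hy.2, Multiset.prod_cons])
    have := eq_singleton_of_prod_eq hv (right_ne_zero_of_mul h0)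
      (fun L hL => hy.1 L (Multiset.mem_cons_of_mem hL)) ht'
    rw [this, Multiset.card_singleton] at h3
    omega
  have hsub : y - x = y := by
    have := Multiset.sub_add_inter y x
    rwa [Multiset.inter_comm, Multiset.inter_eq_zero_iff_disjoint.mpr hdisj, add_zero] at this
  unfold factDist
  refine le_max_of_le_right (le_of_eq ?_)
  convert! (congrArg Multiset.card hsub).symm

variable [IsPrincipalIdealRing D]

lemma three_notMem_lengthSet_pow_four (hp : Prime p) : 3 ∉ lengthSet (pair (p ^ 4) 0) := by
  rw [mem_lengthSet_iff]
  rintro ⟨z, hz, h3⟩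
  rw [mem_factorizations_iff (not_isUnit_pair_pow hp (by omega) 0)] at hz
  have h40 : p ^ 4 ≠ 0 := pow_ne_zero 4 hp.ne_zero
  have hat : ∀ I ∈ z, IsAtomAt p I := by
    intro I hI
    have hIe : I ≠ epsIdeal D := fun h => epsIdeal_notMem h40 hz.2 (h ▸ hI)
    refine (hz.1 I hI).isAtomAt hIe hp ?_
    obtain ⟨q, hq, k, y, hk, -, rfl⟩ := (hz.1 I hI).classify hIe
    have hle := hz.2 ▸ multiset_prod_le_of_mem hI
    rw [Ideal.span_singleton_le_span_singleton] at hle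
    have h1 := map_dvd (fst : selfIdealization D →+* D) hle
    rw [fst_pair, fst_pair] at h1
    have hqp : q ∣ p := hq.dvd_of_dvd_pow ((dvd_pow_self q (by omega)).trans h1)
    exact span_le_primeAbove.mpr
      ((hq.associated_of_dvd hp hqp).symm.dvd.trans (dvd_pow_self q (by omega)))
  obtain ⟨I, J, K, rfl⟩ := Multiset.card_eq_three.mp h3
  obtain ⟨i, x, hi, hx, rfl⟩ := hat I (by simp)
  obtain ⟨j, y, hj, hy, rfl⟩ := hat J (by simp)
  obtain ⟨k, w, hk, hw, rfl⟩ := hat K (by simp)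
  have hprod := hz.2
  simp only [Multiset.insert_eq_cons, Multiset.prod_cons, Multiset.prod_singleton,
    Ideal.span_singleton_mul_span_singleton, pair_mul] at hprod
  obtain ⟨u, hu⟩ := (span_eq_iff.mp hprod).symm
  obtain ⟨c, d, hcd⟩ := exists_eq_pair (u : selfIdealization D)
  have hc : IsUnit c := isUnit_pair.mp (hcd ▸ u.isUnit)
  rw [hcd, pair_mul, pair_inj, ← pow_add, ← pow_add] at hu
  obtain ⟨hu1, hu2⟩ := hu
  have hsum : i + (j + k) = 4 := by
    have hass : Associated (p ^ 4) (p ^ (i + (j + k))) := ⟨hc.unit, hu1⟩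
    exact le_antisymm ((pow_dvd_pow_iff hp.ne_zero hp.not_isUnit).mp hass.symm.dvd)
      ((pow_dvd_pow_iff hp.ne_zero hp.not_isUnit).mp hass.dvd)
  -- exactly one of the exponents is `2`, and the off-diagonal entry of the product is then
  -- divisible by `p ^ 2` only
  have contra : ∀ x y w : D, (2 = 1 ∨ ¬ p ∣ x) → p ^ 4 * d = p ^ 3 * w + p ^ 3 * y + p ^ 2 * x →
      False := by
    intro x y w hx h
    refine hx.resolve_left (by omega) ⟨p * d - w - y, ?_⟩
    exact mul_left_cancel₀ (pow_ne_zero 2 hp.ne_zero) (by linear_combination -h)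
  have hcases : (i = 2 ∧ j = 1 ∧ k = 1) ∨ (i = 1 ∧ j = 2 ∧ k = 1) ∨ (i = 1 ∧ j = 1 ∧ k = 2) := by
    omega
  rcases hcases with ⟨rfl, rfl, rfl⟩ | ⟨rfl, rfl, rfl⟩ | ⟨rfl, rfl, rfl⟩
  · exact contra x y w hx (by linear_combination hu2)
  · exact contra y x w hy (by linear_combination hu2)
  · exact contra w y x hw (by linear_combination hu2)

lemma four_le_catenaryDegreeAt (hp : Prime p) : 4 ≤ catenaryDegreeAt (pair (p ^ 4) 0) := by
  have hna := not_isUnit_pair_pow hp (n := 4) (by omega) 0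
  have h40 : p ^ 4 ≠ 0 := pow_ne_zero 4 hp.ne_zero
  refine le_sInf fun N hN => ?_
  by_contra! hlt
  obtain ⟨z, hz, hz2⟩ := mem_lengthSet_iff.mp (two_mem_lengthSet_pow_four hp)
  obtain ⟨z', hz', hz4⟩ := mem_lengthSet_iff.mp (four_mem_lengthSet_pow_four hp)
  -- a chain that starts with length `2` and has distances less than `4` never leaves length `2`
  have key : ∀ y, ChainConnected (pair (p ^ 4) 0) N z y → Multiset.card y = 2 := by
    intro y hy
    induction hy with
    | refl => exact hz2
    | @tail x y _ hxy ih =>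
      obtain ⟨hx, hy, hd⟩ := hxy
      have hd4 : factDist x y < 4 := by exact_mod_cast hd.trans_lt hlt
      have h3 : Multiset.card y ≠ 3 := fun h =>
        three_notMem_lengthSet_pow_four hp (mem_lengthSet_iff.mpr ⟨y, hy, h⟩)
      rw [mem_factorizations_iff hna] at hx hy
      have hge : 2 ≤ Multiset.card y := by
        by_contra! h
        rcases Nat.lt_or_ge 0 (Multiset.card y) with hpos | hpos
        · obtain ⟨I, rfl⟩ := Multiset.card_eq_one.mp (show Multiset.card y = 1 by omega)
          obtain ⟨u, hu, rfl⟩ := hy.1 I (by simp)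
          have hspan := hy.2
          rw [Multiset.prod_singleton] at hspan
          have := eq_singleton_of_prod_eq hu (fst_ne_zero_of_span_eq hspan.symm (by simpa using h40))
            hx.1 (hx.2.trans hspan.symm)
          rw [this, Multiset.card_singleton] at ih
          omega
        · rw [Multiset.card_eq_zero.mp (Nat.le_zero.mp hpos)] at hy
          refine hna (Ideal.span_singleton_eq_top.mp ?_)
          rw [← hy.2, Multiset.prod_zero, Ideal.one_eq_top]
      by_contra h2
      have := card_le_factDist h40 hx hy ih (by omega)
      omega
  have := key z' (hN z hz z' hz')
  omega

end FourthPower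

variable [IsPrincipalIdealRing D]

lemma catenaryDegreeAt_le_four {a : selfIdealization D} (h0 : a ≠ 0) (ha : ¬ IsUnit a) :
    catenaryDegreeAt a ≤ 4 := by
  refine sInf_le fun z hz z' hz' => ?_
  have hl := linked_of_mem_factorizations h0 ha hz hz'
  clear hz'
  induction hl with
  | refl => exact Relation.ReflTransGen.refl
  | @tail x y hzx hxy ih =>
    have hx := Linked.isFactorization hzx ((mem_factorizations_iff ha).mp hz)
    have hy : IsFactorization y (Ideal.span {a}) := ⟨hxy.2.1, hxy.2.2.1.symm.trans hx.2⟩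
    exact ih.tail ⟨(mem_factorizations_iff ha).mpr hx, (mem_factorizations_iff ha).mpr hy,
      by exact_mod_cast hxy.2.2.2.1⟩

lemma le_two_of_mem_distances {a : selfIdealization D} (h0 : a ≠ 0) (ha : ¬ IsUnit a) {d : ℕ}
    (hd : d ∈ distances a) : d ≤ 2 := by
  obtain ⟨k, hk, l, hl, hkl, hgap, rfl⟩ := hd
  obtain ⟨z, hz, rfl⟩ := mem_lengthSet_iff.mp hk
  obtain ⟨z', hz', rfl⟩ := mem_lengthSet_iff.mp hl
  by_contra! hlt
  have key : ∀ y, Linked z y → Multiset.card y ≤ Multiset.card z := by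
    intro y hy
    induction hy with
    | refl => exact le_rfl
    | @tail x y hzx hxy ih =>
      have hy := Linked.isFactorization (Relation.ReflTransGen.tail hzx hxy)
        ((mem_factorizations_iff ha).mp hz)
      have := hgap _ (mem_lengthSet_iff.mpr ⟨y, (mem_factorizations_iff ha).mpr hy, rfl⟩)
      have := hxy.2.2.2.2.2
      omega
  have := key z' (linked_of_mem_factorizations h0 ha hz hz')
  omega

lemma exists_prime_of_not_isField (hD : ¬ IsField D) : ∃ p : D, Prime p := by
  obtain ⟨a, ha0, ha⟩ := Ring.exists_not_isUnit_of_not_isField hD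
  obtain ⟨p, hp, -⟩ := WfDvdMonoid.exists_irreducible_factor ha ha0
  exact ⟨p, hp.prime⟩

theorem catenaryDegree_eq_four (hD : ¬ IsField D) : catenaryDegree (selfIdealization D) = 4 := by
  obtain ⟨p, hp⟩ := exists_prime_of_not_isField hD
  refine le_antisymm (iSup_le fun a => catenaryDegreeAt_le_four a.2.1 a.2.2) ?_
  refine (four_le_catenaryDegreeAt hp).trans (le_iSup
    (fun a : {a : selfIdealization D // a ≠ 0 ∧ ¬ IsUnit a} => catenaryDegreeAt a.1)
    ⟨pair (p ^ 4) 0, fun h => ?_, not_isUnit_pair_pow hp (by omega) 0⟩)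
  rw [← pair_zero, pair_inj] at h
  exact pow_ne_zero 4 hp.ne_zero h.1

theorem ringDistances_eq (hD : ¬ IsField D) :
    ringDistances (selfIdealization D) = {d : ℕ | 1 ≤ d ∧ d ≤ 2} := by
  obtain ⟨p, hp⟩ := exists_prime_of_not_isField hD
  ext d
  constructor
  · rintro ⟨a, h0, ha, hd⟩
    refine ⟨?_, le_two_of_mem_distances h0 ha hd⟩
    obtain ⟨k, -, l, -, hkl, -, rfl⟩ := hd
    omega
  · rintro ⟨h1, h2⟩
    rcases (by omega : d = 1 ∨ d = 2) with rfl | rfl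
    · -- `(0, p ^ 2) = ε (p ^ 2, 1) = ε (p, 0) (p, 0)`
      refine ⟨pair 0 (p ^ 2), fun h => ?_, ?_, 2, ?_, 3, ?_, by omega, fun m _ => by omega, rfl⟩
      · rw [← pair_zero, pair_inj] at h
        exact pow_ne_zero 2 hp.ne_zero h.2
      · rw [isUnit_pair]
        exact not_isUnit_zero
      · have hp1 : ¬ p ∣ 1 := fun h => hp.not_isUnit (isUnit_of_dvd_one h)
        refine ⟨pair 0 1 ::ₘ pair (p ^ 2) 1 ::ₘ 0, ?_, ?_, rfl⟩
        · exact Multiset.forall_mem_cons.mpr ⟨isAtomElt_eps, Multiset.forall_mem_cons.mpr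
            ⟨isAtomElt_pair_pow hp (by omega) (Or.inr hp1),
              fun u hu => absurd hu (Multiset.notMem_zero u)⟩⟩
        · simp [pair_mul]
      · refine ⟨pair 0 1 ::ₘ Multiset.replicate 2 (pair p 0), ?_, ?_, rfl⟩
        · refine Multiset.forall_mem_cons.mpr ⟨isAtomElt_eps, fun u hu => ?_⟩
          rw [Multiset.eq_of_mem_replicate hu]
          simpa using isAtomElt_pair_pow (y := 0) hp le_rfl (Or.inl rfl)
        · simp [pair_mul, pow_two]
    · -- `(p ^ 4, 0) = (p ^ 2, 1) (p ^ 2, -1) = (p, 0) ^ 4`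
      refine ⟨pair (p ^ 4) 0, fun h => ?_, not_isUnit_pair_pow hp (by omega) 0, 2,
        two_mem_lengthSet_pow_four hp, 4, four_mem_lengthSet_pow_four hp, by omega,
        fun m hm hlt => ?_, rfl⟩
      · rw [← pair_zero, pair_inj] at h
        exact pow_ne_zero 4 hp.ne_zero h.1
      · obtain rfl : m = 3 := by omega
        exact three_notMem_lengthSet_pow_four hp hm

end Degree

end SelfIdeal

theorem corollary3p5 (D : Type*) [CommRing D] [IsDomain D] [IsPrincipalIdealRing D]
    (hD : ¬ IsField D) :
    SelfIdeal.IsLocallyTame (SelfIdeal.selfIdealization D) ∧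
      SelfIdeal.catenaryDegree (SelfIdeal.selfIdealization D) = 4 ∧
      SelfIdeal.ringDistances (SelfIdeal.selfIdealization D) =
        {d : ℕ | 1 ≤ d ∧
          (d : ℕ∞) ≤ SelfIdeal.catenaryDegree (SelfIdeal.selfIdealization D) - 2} := by
  refine ⟨SelfIdeal.isLocallyTame, SelfIdeal.catenaryDegree_eq_four hD, ?_⟩
  rw [SelfIdeal.catenaryDegree_eq_four hD, SelfIdeal.ringDistances_eq hD]
  ext d
  have h : (4 - 2 : ℕ∞) = ((2 : ℕ) : ℕ∞) := rfl
  simp only [Set.mem_ofPred_eq]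
  rw [h, Nat.cast_le]
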